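/- A sublebesgue measure is a measure $\mu=f(x)\,dx$ on $[0,1]$ with $f$ measurable and $0\le f\le 1$. For a binary word $w=w_1\cdots w_k$ let $$\rho_w(\mu)=k!\int_{0\le x_1<\dots<x_k\le 1}\prod_{i=1}^k g_i(x_i)\,dx_1\cdots dx_k,\qquad g_i=\begin{cases}f& w_i=1\\ 1-f& w_i=0,\end{cases}$$ so that in particular $\rho_1(\mu)=\int_0^1 f(x)\,dx$. Let $\rho\in[0,1]$. Among all sublebesgue measures $\mu$ with $\rho_1(\mu)=\rho$, the maximum of $\rho_{1010}(\mu)$ exists and equals $\frac{12}{e^2}\rho^2(1-\rho)^2$. It is attained by exactly one sublebesgue measure, namely the one with density (up to Lebesgue-null sets) $$f(x)=\begin{cases}1& 0\le x<\frac{\rho}{e}\\[2pt] \frac12\left(1+\frac{e^{1/2}(x+\rho-1)}{\sqrt{4\rho(1-\rho)+e(x+\rho-1)^2}}\right)&\frac{\rho}{e}<x<1-\frac{1-\rho}{e}\\[2pt] 0& 1-\frac{1-\rho}{e}<x\le 1.\end{cases}$$ Moreover, for a word $X\in\{0,1\}^{2n}$ with exactly $n$ ones (a deck of $2n$ cards,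 half black $=1$ and half red $=0$), let $\rho_{1010}(X)$ be the number of occurrences of $1010$ as a not necessarily consecutive subword of $X$, divided by $\binom{2n}{4}$; this is the probability that four cards drawn uniformly at random, kept in deck order, read black, red, black, red. Then the maximum of $\rho_{1010}(X)$ over all such $X$ tends to $\frac{3}{4e^2}$ as $n\to\infty$. -/

import Mathlib

open MeasureTheory Filter Topology Set

noncomputable section

/-- The number `N_w(X)` of occurrences of the word `w` as a (not necessarily consecutive)
subword of `X`; the letters `1` and `0` are `true` and `false`. -/
def patternCount {m n : ℕ} (w : Fin m → Bool) (X : Fin n → Bool) : ℕ :=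
  Nat.card {e : Fin m ↪o Fin n // ∀ i, X (e i) = w i}

/-- The density `N_w(X) / (n choose m)` of `w` in a finite binary word `X`, i.e. the probability
that a uniformly random length-`m` subsequence of `X` equals `w`. -/
def wordDensity {m n : ℕ} (w : Fin m → Bool) (X : Fin n → Bool) : ℝ :=
  (patternCount w X : ℝ) / (n.choose m : ℝ)

/-- Lebesgue measure on `[0,1]`, as a measure on the real line. -/
def lebesgueUnit : Measure ℝ := volume.restrict (Icc (0 : ℝ) 1)

/-- Sublebesgue measures: the measures `f(x) dx` on `[0,1]` with `f` taking values in `[0,1]`. -/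
def IsSublebesgue (μ : Measure ℝ) : Prop :=
  ∃ f : ℝ → ℝ, Measurable f ∧ (∀ x, f x ∈ Icc (0 : ℝ) 1) ∧
    μ = lebesgueUnit.withDensity (fun x => ENNReal.ofReal (f x))

/-- The density of a measure with respect to Lebesgue measure on `[0,1]`. -/
def unitDensity (μ : Measure ℝ) (x : ℝ) : ℝ := (μ.rnDeriv lebesgueUnit x).toReal

/-- The ordered simplex `0 ≤ x₁ < ⋯ < x_k ≤ 1`. -/
def orderedSimplex (k : ℕ) : Set (Fin k → ℝ) :=
  {x | StrictMono x ∧ ∀ i, x i ∈ Icc (0 : ℝ) 1}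

/-- The density `ρ_w(μ)` of the word `w` of length `k` in the sublebesgue measure `μ = f(x) dx`:
`k!` times the integral over the ordered simplex of the product over `i` of
`f(x_i)` (if `w_i = 1`) or `1 - f(x_i)` (if `w_i = 0`). -/
def patternDensity {k : ℕ} (w : Fin k → Bool) (μ : Measure ℝ) : ℝ :=
  (k.factorial : ℝ) *
    ∫ x in orderedSimplex k,
      ∏ i, (if w i = true then unitDensity μ (x i) else 1 - unitDensity μ (x i))

/-- The word `1`. -/
def word1 : Fin 1 → Bool := ![true]

/-- The word `1010`. -/
def word1010 : Fin 4 → Bool := ![true, false, true, false]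

/-- The explicit optimal density. -/
def optimalDensity (ρ x : ℝ) : ℝ :=
  if x < ρ / Real.exp 1 then 1
  else if x ≤ 1 - (1 - ρ) / Real.exp 1 then
    (1 / 2) * (1 + Real.exp (1 / 2) * (x + ρ - 1) /
      Real.sqrt (4 * ρ * (1 - ρ) + Real.exp 1 * (x + ρ - 1) ^ 2))
  else 0

/-- The sublebesgue measures `μ` with `ρ_1(μ) = ρ`. -/
def sublebesgueWithMass (ρ : ℝ) : Set (Measure ℝ) :=
  {μ | IsSublebesgue μ ∧ patternDensity word1 μ = ρ}

/-- The winning probabilities in the BRBR game of all arrangements of a deck of `2 * n` cards,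
`n` of them black (`true`) and `n` red (`false`). -/
def brbrProbabilities (n : ℕ) : Set ℝ :=
  {p | ∃ X : Fin (2 * n) → Bool,
    (Finset.univ.filter (fun i => X i = true)).card = n ∧ p = wordDensity word1010 X}

end

/-!
Let `a x` be the mass of ones before `x` and `c x` the mass of zeros after `x`. Integrating by
parts turns the density of `1010` in `μ` into `24 * ((∫ c ∂μ) ^ 2 / 2 - ∫ a * c ^ 2 ∂μ)`. The map
`a` pushes `μ` forward to Lebesgue measure on `[0, ρ]`, and `0 ≤ c ≤ 1 - ρ`. Once the square is
linearized with the value of `∫ c ∂μ` as multiplier, the integrand can be maximized pointwise in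
`a`: the best `c` is constant for `a` up to a threshold `k` and proportional to `1 / a` beyond it.
The remaining one-parameter problem is solved by `k = ρ / e`. Equality forces `c`, hence the
position `x` (as `x` is the sum of the ones and zeros before it), to be a given function of `a`, so
`μ` is the push-forward of Lebesgue measure on `[0, ρ]` under that function and is unique.

A deck is a step density: adjacent letters of `1010` differ, so no two points of an increasing tuple
reading `1010` lie in the same step, and the counts of `1010` agree up to normalization. Pattern
densities are Lipschitz in the mass function for the sup norm, so rounding the mass function of the
optimal density gives asymptotically optimal decks.
-/

section CutProfile

variable {A B k : ℝ}

/-- The extremal profile of height `B` with threshold `k`: constant equal to `B` up to `k`, then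
decaying like `1 / s`. It maximizes `2 * B * k * x - s * x ^ 2` over `x ∈ [0, B]`, pointwise
in `s`. -/
noncomputable def cutProfile (B k s : ℝ) : ℝ := B * k / max s k

theorem cutProfile_of_le (hk : 0 < k) {s : ℝ} (h : s ≤ k) : cutProfile B k s = B := by
  rw [cutProfile, max_eq_right h, mul_div_cancel_right₀ _ hk.ne']

theorem cutProfile_of_ge {s : ℝ} (h : k ≤ s) : cutProfile B k s = B * k / s := by
  rw [cutProfile, max_eq_left h]

theorem continuous_cutProfile (hk : 0 < k) : Continuous (cutProfile B k) :=
  continuous_const.div (continuous_id.max continuous_const) fun _ => (lt_max_of_lt_right hk).ne'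

@[fun_prop]
theorem measurable_cutProfile : Measurable (cutProfile B k) :=
  measurable_const.div (measurable_id.max measurable_const)

theorem cutProfile_mem_Icc (hB : 0 ≤ B) (hk : 0 < k) (s : ℝ) : cutProfile B k s ∈ Icc 0 B := by
  have hmax : 0 < max s k := lt_max_of_lt_right hk
  refine ⟨by unfold cutProfile; positivity, ?_⟩
  rw [cutProfile, div_le_iff₀ hmax]
  exact mul_le_mul_of_nonneg_left (le_max_right _ _) hB

theorem sub_mul_sq_add_le_cutProfile {s x : ℝ} (hk : 0 < k) (hx : x ∈ Icc 0 B) :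
    2 * (B * k) * x - s * x ^ 2 + s * (x - cutProfile B k s) ^ 2
      ≤ 2 * (B * k) * cutProfile B k s - s * cutProfile B k s ^ 2 := by
  have variational : 0 ≤ (s * cutProfile B k s - B * k) * (x - cutProfile B k s) := by
    rcases le_total s k with h | h
    · rw [cutProfile_of_le hk h]
      exact mul_nonneg_of_nonpos_of_nonpos
        (by nlinarith [mul_le_mul_of_nonneg_left h (hx.1.trans hx.2)]) (by linarith [hx.2])
    · rw [cutProfile_of_ge h, mul_div_cancel₀ _ (hk.trans_le h).ne', sub_self, zero_mul]
  linarith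

theorem integral_eq_add_mul_log {f : ℝ → ℝ} (hf : Continuous f) (hk : 0 < k)
    (hkA : k ≤ A) {u C : ℝ} (hlow : ∫ s in (0 : ℝ)..k, f s = u)
    (hhigh : ∀ s, k ≤ s → f s = C * s⁻¹) :
    ∫ s in (0 : ℝ)..A, f s = u + C * Real.log (A / k) := by
  rw [← intervalIntegral.integral_add_adjacent_intervals (hf.intervalIntegrable 0 k)
    (hf.intervalIntegrable k A), hlow,
    intervalIntegral.integral_congr (a := k) (g := fun s => C * s⁻¹)
      fun s hs => hhigh s (uIcc_of_le hkA ▸ hs).1,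
    intervalIntegral.integral_const_mul, integral_inv_of_pos hk (hk.trans_le hkA)]

theorem integral_cutProfile (hk : 0 < k) (hkA : k ≤ A) :
    ∫ s in (0 : ℝ)..A, cutProfile B k s = B * k * (1 + Real.log (A / k)) := by
  have hlow : ∫ s in (0 : ℝ)..k, cutProfile B k s = B * k := by
    rw [intervalIntegral.integral_congr (g := fun _ => B)
      fun s hs => cutProfile_of_le hk (uIcc_of_le hk.le ▸ hs).2]
    simp [mul_comm]
  rw [integral_eq_add_mul_log (continuous_cutProfile hk) hk hkA hlow
    fun s hs => by rw [cutProfile_of_ge hs, div_eq_mul_inv]]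
  ring

theorem integral_mul_cutProfile_sq (hk : 0 < k) (hkA : k ≤ A) :
    ∫ s in (0 : ℝ)..A, s * cutProfile B k s ^ 2
      = (B * k) ^ 2 * (1 / 2 + Real.log (A / k)) := by
  have hlow : ∫ s in (0 : ℝ)..k, s * cutProfile B k s ^ 2 = (B * k) ^ 2 / 2 := by
    rw [intervalIntegral.integral_congr (g := fun s => s * B ^ 2)
      fun s hs => by simp only [cutProfile_of_le hk (uIcc_of_le hk.le ▸ hs).2],
      intervalIntegral.integral_mul_const, integral_id]
    ring
  have hcont := continuous_cutProfile (B := B) hk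
  rw [integral_eq_add_mul_log (f := fun s => s * cutProfile B k s ^ 2)
    (C := (B * k) ^ 2) (by fun_prop) hk hkA hlow fun s hs => by
      have : s ≠ 0 := (hk.trans_le hs).ne'
      simp only [cutProfile_of_ge hs]
      field_simp]
  ring

end CutProfile

section ExtremalProfile

variable {Ω : Type*} [MeasurableSpace Ω] {μ : Measure Ω} {A B k : ℝ} {a c : Ω → ℝ}

theorem integral_comp_eq_intervalIntegral (hA : 0 ≤ A)
    (ha : MeasurePreserving a μ (volume.restrict (Icc 0 A))) {φ : ℝ → ℝ} (hφ : Continuous φ) :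
    ∫ ω, φ (a ω) ∂μ = ∫ s in (0 : ℝ)..A, φ s := by
  rw [← integral_map ha.aemeasurable hφ.aestronglyMeasurable, ha.map_eq,
    intervalIntegral.integral_of_le hA, integral_Icc_eq_integral_Ioc]

theorem isFiniteMeasure_of_measurePreserving
    (ha : MeasurePreserving a μ (volume.restrict (Icc 0 A))) : IsFiniteMeasure μ :=
  have : IsFiniteMeasure (μ.map a) := by rw [ha.map_eq]; infer_instance
  Measure.isFiniteMeasure_of_map ha.aemeasurable

theorem ae_mem_Icc_of_measurePreserving
    (ha : MeasurePreserving a μ (volume.restrict (Icc 0 A))) : ∀ᵐ ω ∂μ, a ω ∈ Icc 0 A :=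
  ha.quasiMeasurePreserving.ae (ae_restrict_mem measurableSet_Icc)

theorem integrable_of_ae_mem_Icc [IsFiniteMeasure μ] (hc : AEStronglyMeasurable c μ)
    (hcB : ∀ᵐ ω ∂μ, c ω ∈ Icc 0 B) : Integrable c μ :=
  Integrable.of_bound hc B
    (hcB.mono fun ω h => by rw [Real.norm_of_nonneg h.1]; exact h.2)

theorem integrable_mul_sq (ha : MeasurePreserving a μ (volume.restrict (Icc 0 A)))
    (hc : AEStronglyMeasurable c μ) (hcB : ∀ᵐ ω ∂μ, |c ω| ≤ B) :
    Integrable (fun ω => a ω * c ω ^ 2) μ := by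
  have := isFiniteMeasure_of_measurePreserving ha
  refine Integrable.of_bound (ha.measurable.aestronglyMeasurable.mul (hc.pow 2)) (A * B ^ 2) ?_
  filter_upwards [ae_mem_Icc_of_measurePreserving ha, hcB] with ω ha hc
  rw [Real.norm_eq_abs, abs_mul, abs_of_nonneg ha.1, abs_pow]
  exact mul_le_mul ha.2 (pow_le_pow_left₀ (abs_nonneg _) hc 2) (by positivity) (ha.1.trans ha.2)

/-- The quadratic functional that, up to the factor `24`, is the density of the word `1010` when
`a` is the mass of ones before a point and `c` the mass of zeros after it. -/
noncomputable def profileScore (μ : Measure Ω) (a c : Ω → ℝ) : ℝ :=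
  (∫ ω, c ω ∂μ) ^ 2 / 2 - ∫ ω, a ω * c ω ^ 2 ∂μ

theorem profileScore_congr {d : Ω → ℝ} (h : c =ᵐ[μ] d) :
    profileScore μ a c = profileScore μ a d := by
  have hsq : (fun ω => a ω * c ω ^ 2) =ᵐ[μ] fun ω => a ω * d ω ^ 2 :=
    h.mono fun ω h => by simp only [h]
  rw [profileScore, profileScore, integral_congr_ae h, integral_congr_ae hsq]

theorem profileScore_cutProfile (ha : MeasurePreserving a μ (volume.restrict (Icc 0 A)))
    (hk : 0 < k) (hkA : k ≤ A) :
    profileScore μ a (fun ω => cutProfile B k (a ω)) = (B * k * Real.log (A / k)) ^ 2 / 2 := by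
  have hcont := continuous_cutProfile (B := B) hk
  rw [profileScore, integral_comp_eq_intervalIntegral (hk.le.trans hkA) ha hcont,
    integral_comp_eq_intervalIntegral (φ := fun s => s * cutProfile B k s ^ 2)
      (hk.le.trans hkA) ha (by fun_prop),
    integral_cutProfile hk hkA, integral_mul_cutProfile_sq hk hkA]
  ring

/-- The multiplier `2 * B * k = ∫ c` linearizes the square: `T ^ 2 / 2 = T * T - T ^ 2 / 2`. -/
theorem profileScore_add_integral_le
    (ha : MeasurePreserving a μ (volume.restrict (Icc 0 A))) (hc : AEStronglyMeasurable c μ)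
    (hcB : ∀ᵐ ω ∂μ, c ω ∈ Icc 0 B) (hB : 0 ≤ B) (hk : 0 < k) (hkA : k ≤ A)
    (hT : ∫ ω, c ω ∂μ = 2 * (B * k)) :
    profileScore μ a c + ∫ ω, a ω * (c ω - cutProfile B k (a ω)) ^ 2 ∂μ
      ≤ (B * k) ^ 2 * (Real.log (A / k) - 1 / 2) := by
  have := isFiniteMeasure_of_measurePreserving ha
  have hcont := continuous_cutProfile (B := B) hk
  set d : Ω → ℝ := fun ω => cutProfile B k (a ω)
  have hdm : AEStronglyMeasurable d μ :=
    (measurable_cutProfile.comp ha.measurable).aestronglyMeasurable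
  have hdB : ∀ ω, d ω ∈ Icc 0 B := fun ω => cutProfile_mem_Icc hB hk _
  have hci := integrable_of_ae_mem_Icc hc hcB
  have hdi := integrable_of_ae_mem_Icc hdm (ae_of_all _ hdB)
  have hac := integrable_mul_sq ha hc (hcB.mono fun ω h => (abs_of_nonneg h.1).trans_le h.2)
  have had := integrable_mul_sq ha hdm
    (ae_of_all _ fun ω => (abs_of_nonneg (hdB ω).1).trans_le (hdB ω).2)
  have hacd := integrable_mul_sq ha (hc.sub hdm)
    (hcB.mono fun ω h => abs_sub_le_of_nonneg_of_le h.1 h.2 (hdB ω).1 (hdB ω).2)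
  have hd : ∫ ω, d ω ∂μ = B * k * (1 + Real.log (A / k)) := by
    rw [integral_comp_eq_intervalIntegral (hk.le.trans hkA) ha hcont, integral_cutProfile hk hkA]
  have had2 : ∫ ω, a ω * d ω ^ 2 ∂μ = (B * k) ^ 2 * (1 / 2 + Real.log (A / k)) := by
    rw [integral_comp_eq_intervalIntegral (φ := fun s => s * cutProfile B k s ^ 2)
      (hk.le.trans hkA) ha (by fun_prop), integral_mul_cutProfile_sq hk hkA]
  have lagrange := integral_mono_ae (((hci.const_mul (2 * (B * k))).sub hac).add hacd)
    ((hdi.const_mul (2 * (B * k))).sub had) (hcB.mono fun ω h => sub_mul_sq_add_le_cutProfile hk h)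
  rw [integral_add' ((hci.const_mul _).sub hac) hacd, integral_sub' (hci.const_mul _) hac,
    integral_sub' (hdi.const_mul _) had, integral_const_mul, integral_const_mul, hT, hd, had2]
    at lagrange
  simp only [Pi.sub_apply] at lagrange
  rw [profileScore, hT]
  linarith

theorem mul_exp_neg_eq_exp_neg_one_iff {y : ℝ} :
    y * Real.exp (-y) = Real.exp (-1) ↔ y = 1 := by
  refine ⟨fun h => ?_, fun h => by rw [h, one_mul]⟩
  by_contra hne
  have hlt := Real.add_one_lt_exp (sub_ne_zero.mpr hne)
  have : Real.exp (-1) = Real.exp (y - 1) * Real.exp (-y) := by rw [← Real.exp_add]; ring_nf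
  rw [this] at h
  linarith [mul_right_cancel₀ (Real.exp_ne_zero _) h]

theorem sq_mul_log_div_sub_half (hA : 0 < A) (hk : 0 < k) :
    k ^ 2 * (Real.log (A / k) - 1 / 2) = A ^ 2 * Real.exp (-1) / 2 *
      ((2 * Real.log (A / k) - 1) * Real.exp (-(2 * Real.log (A / k) - 1))) := by
  have hexp : Real.exp (-1) * Real.exp (-(2 * Real.log (A / k) - 1)) = (k / A) ^ 2 := by
    rw [← Real.exp_add, ← Real.exp_log (show 0 < k / A by positivity), ← Real.exp_nat_mul,
      ← inv_div A k, Real.log_inv]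
    congr 1
    push_cast
    ring
  have hkA : k ^ 2 = A ^ 2 * (k / A) ^ 2 := by field_simp
  rw [hkA, ← hexp]
  ring

theorem sq_mul_log_div_sub_half_le (hA : 0 < A) (hk : 0 < k) :
    k ^ 2 * (Real.log (A / k) - 1 / 2) ≤ (A * Real.exp (-1)) ^ 2 / 2 := by
  rw [sq_mul_log_div_sub_half hA hk]
  calc _ ≤ A ^ 2 * Real.exp (-1) / 2 * Real.exp (-1) := by
        gcongr
        exact Real.mul_exp_neg_le_exp_neg_one _
    _ = (A * Real.exp (-1)) ^ 2 / 2 := by ring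

theorem eq_mul_exp_of_sq_mul_log_div_sub_half_eq (hA : 0 < A) (hk : 0 < k)
    (h : k ^ 2 * (Real.log (A / k) - 1 / 2) = (A * Real.exp (-1)) ^ 2 / 2) :
    k = A * Real.exp (-1) := by
  rw [sq_mul_log_div_sub_half hA hk, show (A * Real.exp (-1)) ^ 2 / 2
    = A ^ 2 * Real.exp (-1) / 2 * Real.exp (-1) by ring] at h
  have hy := mul_exp_neg_eq_exp_neg_one_iff.mp (mul_left_cancel₀ (by positivity) h)
  have hlog : Real.log (A / k) = 1 := by linarith
  rw [Real.exp_neg, ← hlog, Real.exp_log (by positivity), inv_div, mul_div_cancel₀ _ hA.ne']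

theorem integral_le_mul_of_measurePreserving (hA : 0 ≤ A)
    (ha : MeasurePreserving a μ (volume.restrict (Icc 0 A))) (hc : AEStronglyMeasurable c μ)
    (hcB : ∀ᵐ ω ∂μ, c ω ∈ Icc 0 B) : ∫ ω, c ω ∂μ ≤ A * B := by
  have := isFiniteMeasure_of_measurePreserving ha
  calc ∫ ω, c ω ∂μ ≤ ∫ _, B ∂μ :=
        integral_mono_ae (integrable_of_ae_mem_Icc hc hcB) (integrable_const _)
          (hcB.mono fun ω h => h.2)
    _ = A * B := by
        rw [integral_comp_eq_intervalIntegral (φ := fun _ => B) hA ha continuous_const]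
        simp

theorem profileScore_le_zero_of_integral_eq_zero
    (ha : MeasurePreserving a μ (volume.restrict (Icc 0 A))) (hT : ∫ ω, c ω ∂μ = 0) :
    profileScore μ a c ≤ 0 := by
  have : 0 ≤ ∫ ω, a ω * c ω ^ 2 ∂μ := integral_nonneg_of_ae
    ((ae_mem_Icc_of_measurePreserving ha).mono fun ω h => mul_nonneg h.1 (sq_nonneg _))
  rw [profileScore, hT]
  linarith

theorem ae_ne_zero_of_measurePreserving
    (ha : MeasurePreserving a μ (volume.restrict (Icc 0 A))) : ∀ᵐ ω ∂μ, a ω ≠ 0 :=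
  ha.quasiMeasurePreserving.ae (ae_restrict_of_ae (Measure.ae_ne volume 0))

theorem pos_and_pos_of_integral_pos (hA : 0 ≤ A) (hB : 0 ≤ B)
    (ha : MeasurePreserving a μ (volume.restrict (Icc 0 A))) (hc : AEStronglyMeasurable c μ)
    (hcB : ∀ᵐ ω ∂μ, c ω ∈ Icc 0 B) (hT : 0 < ∫ ω, c ω ∂μ) : 0 < A ∧ 0 < B := by
  have hAB := hT.trans_le (integral_le_mul_of_measurePreserving hA ha hc hcB)
  exact ⟨pos_of_mul_pos_left hAB hB, pos_of_mul_pos_right hAB hA⟩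

theorem exists_profileScore_add_integral_le (hA : 0 ≤ A) (hB : 0 < B)
    (ha : MeasurePreserving a μ (volume.restrict (Icc 0 A))) (hc : AEStronglyMeasurable c μ)
    (hcB : ∀ᵐ ω ∂μ, c ω ∈ Icc 0 B) (hT : 0 < ∫ ω, c ω ∂μ) :
    ∃ k > 0, profileScore μ a c + ∫ ω, a ω * (c ω - cutProfile B k (a ω)) ^ 2 ∂μ
      ≤ B ^ 2 * (k ^ 2 * (Real.log (A / k) - 1 / 2)) := by
  have hTle := integral_le_mul_of_measurePreserving hA ha hc hcB
  have hkA : (∫ ω, c ω ∂μ) / (2 * B) ≤ A := by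
    rw [div_le_iff₀ (by positivity)]
    linarith
  refine ⟨(∫ ω, c ω ∂μ) / (2 * B), by positivity, ?_⟩
  have := profileScore_add_integral_le ha hc hcB hB.le (by positivity) hkA (by field_simp)
  rwa [mul_pow, mul_assoc] at this

theorem integral_mul_sub_sq_nonneg (ha : MeasurePreserving a μ (volume.restrict (Icc 0 A)))
    (d : Ω → ℝ) : 0 ≤ ∫ ω, a ω * (c ω - d ω) ^ 2 ∂μ :=
  integral_nonneg_of_ae
    ((ae_mem_Icc_of_measurePreserving ha).mono fun _ h => mul_nonneg h.1 (sq_nonneg _))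

theorem profileScore_le (hA : 0 ≤ A) (hB : 0 ≤ B)
    (ha : MeasurePreserving a μ (volume.restrict (Icc 0 A))) (hc : AEStronglyMeasurable c μ)
    (hcB : ∀ᵐ ω ∂μ, c ω ∈ Icc 0 B) :
    profileScore μ a c ≤ (A * B * Real.exp (-1)) ^ 2 / 2 := by
  rcases (integral_nonneg_of_ae (hcB.mono fun ω h => h.1)).eq_or_lt with hT | hT
  · exact (profileScore_le_zero_of_integral_eq_zero ha hT.symm).trans (by positivity)
  obtain ⟨hA, hB⟩ := pos_and_pos_of_integral_pos hA hB ha hc hcB hT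
  obtain ⟨k, hk, hle⟩ := exists_profileScore_add_integral_le hA.le hB ha hc hcB hT
  calc profileScore μ a c ≤ B ^ 2 * (k ^ 2 * (Real.log (A / k) - 1 / 2)) :=
        (le_add_of_nonneg_right (integral_mul_sub_sq_nonneg ha _)).trans hle
    _ ≤ B ^ 2 * ((A * Real.exp (-1)) ^ 2 / 2) := by
        gcongr
        exact sq_mul_log_div_sub_half_le hA hk
    _ = (A * B * Real.exp (-1)) ^ 2 / 2 := by ring

theorem ae_eq_of_integral_mul_sub_sq_eq_zero
    (ha : MeasurePreserving a μ (volume.restrict (Icc 0 A))) (hc : AEStronglyMeasurable c μ)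
    (hcB : ∀ᵐ ω ∂μ, c ω ∈ Icc 0 B) {d : Ω → ℝ} (hd : AEStronglyMeasurable d μ)
    (hdB : ∀ᵐ ω ∂μ, d ω ∈ Icc 0 B) (h : ∫ ω, a ω * (c ω - d ω) ^ 2 ∂μ = 0) : c =ᵐ[μ] d := by
  have hint := integrable_mul_sq ha (hc.sub hd) (hcB.mp (hdB.mono fun ω hd hc =>
    abs_sub_le_of_nonneg_of_le hc.1 hc.2 hd.1 hd.2))
  have hnonneg : 0 ≤ᵐ[μ] fun ω => a ω * (c ω - d ω) ^ 2 :=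
    (ae_mem_Icc_of_measurePreserving ha).mono fun ω h => mul_nonneg h.1 (sq_nonneg _)
  filter_upwards [(integral_eq_zero_iff_of_nonneg_ae hnonneg hint).mp h,
    ae_ne_zero_of_measurePreserving ha] with ω hzero hne
  simpa [hne, sub_eq_zero] using hzero

theorem ae_eq_cutProfile_of_mul_eq_zero
    (ha : MeasurePreserving a μ (volume.restrict (Icc 0 A))) (hcB : ∀ᵐ ω ∂μ, c ω ∈ Icc 0 B)
    (hAB : A * B = 0) : ∀ᵐ ω ∂μ, c ω = cutProfile B k (a ω) := by
  rcases mul_eq_zero.mp hAB with rfl | rfl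
  · filter_upwards [ae_mem_Icc_of_measurePreserving ha, ae_ne_zero_of_measurePreserving ha]
      with ω hmem hne
    exact absurd (le_antisymm hmem.2 hmem.1) hne
  · filter_upwards [hcB] with ω h
    rw [cutProfile, zero_mul, zero_div, le_antisymm h.2 h.1]

theorem ae_eq_cutProfile_of_profileScore_eq (hA : 0 ≤ A) (hB : 0 ≤ B)
    (ha : MeasurePreserving a μ (volume.restrict (Icc 0 A))) (hc : AEStronglyMeasurable c μ)
    (hcB : ∀ᵐ ω ∂μ, c ω ∈ Icc 0 B)
    (hmax : profileScore μ a c = (A * B * Real.exp (-1)) ^ 2 / 2) :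
    ∀ᵐ ω ∂μ, c ω = cutProfile B (A * Real.exp (-1)) (a ω) := by
  rcases (integral_nonneg_of_ae (hcB.mono fun ω h => h.1)).eq_or_lt with hT | hT
  · have hle := profileScore_le_zero_of_integral_eq_zero ha hT.symm
    refine ae_eq_cutProfile_of_mul_eq_zero ha hcB ?_
    have hsq : (A * B * Real.exp (-1)) ^ 2 = 0 := le_antisymm (by linarith) (sq_nonneg _)
    simpa [Real.exp_ne_zero] using hsq
  obtain ⟨hA, hB⟩ := pos_and_pos_of_integral_pos hA hB ha hc hcB hT
  obtain ⟨k, hk, hle⟩ := exists_profileScore_add_integral_le hA.le hB ha hc hcB hT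
  have hnonneg := integral_mul_sub_sq_nonneg (c := c) ha fun ω => cutProfile B k (a ω)
  have hbound := mul_le_mul_of_nonneg_left (sq_mul_log_div_sub_half_le hA hk) (sq_nonneg B)
  have hmax' : profileScore μ a c = B ^ 2 * ((A * Real.exp (-1)) ^ 2 / 2) := by
    rw [hmax]
    ring
  have hk_eq : k = A * Real.exp (-1) := eq_mul_exp_of_sq_mul_log_div_sub_half_eq hA hk
    (mul_left_cancel₀ (pow_pos hB 2).ne' (by linarith only [hmax', hle, hnonneg, hbound]))
  rw [← hk_eq]
  exact ae_eq_of_integral_mul_sub_sq_eq_zero ha hc hcB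
    (measurable_cutProfile.comp ha.measurable).aestronglyMeasurable
    (ae_of_all _ fun ω => cutProfile_mem_Icc hB.le hk _) (by linarith)

theorem profileScore_eq_of_ae_eq_cutProfile (hA : 0 ≤ A)
    (ha : MeasurePreserving a μ (volume.restrict (Icc 0 A)))
    (h : ∀ᵐ ω ∂μ, c ω = cutProfile B (A * Real.exp (-1)) (a ω)) :
    profileScore μ a c = (A * B * Real.exp (-1)) ^ 2 / 2 := by
  rw [profileScore_congr h]
  rcases hA.eq_or_lt with rfl | hA
  · simp [profileScore, cutProfile]
  have hk : A * Real.exp (-1) ≤ A := mul_le_of_le_one_right hA.le (by simp)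
  rw [profileScore_cutProfile ha (by positivity) hk, div_mul_cancel_left₀ hA.ne',
    ← Real.exp_neg, neg_neg, Real.log_exp]
  ring

theorem profileScore_eq_iff (hA : 0 ≤ A) (hB : 0 ≤ B)
    (ha : MeasurePreserving a μ (volume.restrict (Icc 0 A))) (hc : AEStronglyMeasurable c μ)
    (hcB : ∀ᵐ ω ∂μ, c ω ∈ Icc 0 B) :
    profileScore μ a c = (A * B * Real.exp (-1)) ^ 2 / 2 ↔
      ∀ᵐ ω ∂μ, c ω = cutProfile B (A * Real.exp (-1)) (a ω) :=
  ⟨ae_eq_cutProfile_of_profileScore_eq hA hB ha hc hcB,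
    profileScore_eq_of_ae_eq_cutProfile hA ha⟩

end ExtremalProfile

section Simplex

variable {k : ℕ} {T : Set ℝ} {t : ℝ}

/-- The strictly increasing tuples with entries in `T`. -/
def simplexIn (k : ℕ) (T : Set ℝ) : Set (Fin k → ℝ) :=
  {x | StrictMono x ∧ ∀ i, x i ∈ T}

/-- The iterated integral `∫₀ᵗ uₖ(sₖ) ∫₀^{sₖ} uₖ₋₁(sₖ₋₁) ⋯`, with value `1` for `k = 0`. -/
noncomputable def iteratedPrimitive : (k : ℕ) → (Fin k → ℝ → ℝ) → ℝ → ℝ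
  | 0, _, _ => 1
  | k + 1, u, t =>
    ∫ s in (0 : ℝ)..t, u (Fin.last k) s * iteratedPrimitive k (fun i => u i.castSucc) s

theorem measurableSet_simplexIn (hT : MeasurableSet T) : MeasurableSet (simplexIn k T) := by
  simp only [simplexIn, StrictMono]
  measurability

theorem snoc_mem_simplexIn_succ {s : ℝ} {y : Fin k → ℝ} :
    (Fin.snoc y s : Fin (k + 1) → ℝ) ∈ simplexIn (k + 1) T ↔
      s ∈ T ∧ y ∈ simplexIn k (T ∩ Iio s) := by
  simp only [simplexIn, StrictMono, Fin.forall_fin_succ', Fin.castSucc_lt_castSucc_iff,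
    Fin.castSucc_lt_last, forall_const, (Fin.castSucc_lt_last _).not_gt, IsEmpty.forall_iff,
    implies_true, lt_self_iff_false, and_self, and_true, mem_ofPred_eq,
    Fin.snoc_castSucc, Fin.snoc_last, mem_inter_iff, mem_Iio]
  grind

theorem integral_eq_integral_integral_snoc {Φ : (Fin (k + 1) → ℝ) → ℝ} (hΦ : Integrable Φ) :
    ∫ x, Φ x = ∫ s : ℝ, ∫ y : Fin k → ℝ, Φ (Fin.snoc y s) := by
  have hmp := (volume_preserving_piFinSuccAbove (fun _ : Fin (k + 1) => ℝ) (Fin.last k)).symm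
  rw [← hmp.integral_comp' Φ, Measure.volume_eq_prod, integral_prod]
  · simp only [MeasurableEquiv.piFinSuccAbove_symm_apply, Fin.insertNthEquiv_last]
    rfl
  · exact (hmp.integrable_comp_emb (MeasurableEquiv.measurableEmbedding _)).mpr hΦ

theorem integrableOn_simplexIn {u : Fin k → ℝ → ℝ} (hu : ∀ i, IntegrableOn (u i) T) :
    IntegrableOn (fun x => ∏ i, u i (x i)) (simplexIn k T) := by
  have hbox : IntegrableOn (fun x => ∏ i, u i (x i)) (univ.pi fun _ : Fin k => T) := by
    rw [IntegrableOn, volume_pi, Measure.restrict_pi_pi]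
    exact Integrable.fintype_prod hu
  exact hbox.mono_set fun x hx i _ => hx.2 i

theorem setIntegral_simplexIn_succ (hT : MeasurableSet T) {u : Fin (k + 1) → ℝ → ℝ}
    (hu : ∀ i, IntegrableOn (u i) T) :
    ∫ x in simplexIn (k + 1) T, ∏ i, u i (x i) = ∫ s in T, u (Fin.last k) s *
      ∫ y in simplexIn k (T ∩ Iio s), ∏ i : Fin k, u i.castSucc (y i) := by
  have hS := measurableSet_simplexIn (k := k + 1) hT
  have hslice : ∀ s, MeasurableSet (simplexIn k (T ∩ Iio s)) := fun s =>
    measurableSet_simplexIn (hT.inter measurableSet_Iio)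
  rw [← integral_indicator hS, ← integral_indicator hT, integral_eq_integral_integral_snoc
    ((integrable_indicator_iff hS).mpr (integrableOn_simplexIn hu))]
  congr 1 with s
  by_cases hs : s ∈ T
  · rw [indicator_of_mem hs, ← integral_indicator (hslice s), ← integral_const_mul]
    congr 1 with y
    by_cases hy : y ∈ simplexIn k (T ∩ Iio s)
    · simp [snoc_mem_simplexIn_succ, hs, hy, Fin.prod_univ_castSucc, mul_comm]
    · simp [snoc_mem_simplexIn_succ, hy]
  · simp [snoc_mem_simplexIn_succ, hs]

theorem setIntegral_simplexIn (hT : MeasurableSet T) (hleft : Ico 0 t ⊆ T) (hright : T ⊆ Icc 0 t)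
    (ht : 0 ≤ t) {u : Fin k → ℝ → ℝ} (hu : ∀ i, IntegrableOn (u i) (Icc 0 t)) :
    ∫ x in simplexIn k T, ∏ i, u i (x i) = iteratedPrimitive k u t := by
  induction k generalizing t T with
  | zero =>
    have : simplexIn 0 T = univ := eq_univ_of_forall fun x =>
      ⟨Subsingleton.strictMono x, fun i => i.elim0⟩
    simp [this, iteratedPrimitive, Measure.real, volume_pi]
  | succ k ih =>
    have hTae : T =ᵐ[volume] Ioc 0 t :=
      (hright.eventuallyLE.trans Ico_ae_eq_Icc.symm.le).antisymm hleft.eventuallyLE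
        |>.trans Ico_ae_eq_Ioc
    rw [setIntegral_simplexIn_succ hT fun i => (hu i).mono_set hright, iteratedPrimitive,
      intervalIntegral.integral_of_le ht, ← setIntegral_congr_set hTae]
    refine setIntegral_congr_fun hT fun s hs => ?_
    have hs := hright hs
    rw [ih (hT.inter measurableSet_Iio) (fun x hx => ⟨hleft ⟨hx.1, hx.2.trans_le hs.2⟩, hx.2⟩)
      (fun x hx => ⟨(hright hx.1).1, hx.2.le⟩) hs.1
      fun i => (hu _).mono_set (Icc_subset_Icc_right hs.2)]

end Simplex

section PatternDensity

/-- The densities of sublebesgue measures. -/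
structure IsSublebesgueDensity (f : ℝ → ℝ) : Prop where
  measurable : Measurable f
  mem_Icc : ∀ x, f x ∈ Icc (0 : ℝ) 1

/-- The measure `f(x) dx` on `[0,1]`. -/
noncomputable def withUnitDensity (f : ℝ → ℝ) : Measure ℝ :=
  lebesgueUnit.withDensity fun x => ENNReal.ofReal (f x)

/-- The factor of a letter in a pattern density: `f` for `1` and `1 - f` for `0`. -/
def letterFactor (f : ℝ → ℝ) (b : Bool) (x : ℝ) : ℝ := if b = true then f x else 1 - f x

/-- The mass of ones before `x`. -/
noncomputable def onesBefore (f : ℝ → ℝ) (x : ℝ) : ℝ := ∫ y in (0 : ℝ)..x, f y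

/-- The mass of zeros between `x` and `1`. -/
noncomputable def zerosAfter (f : ℝ → ℝ) (x : ℝ) : ℝ := ∫ y in x..1, (1 - f y)

instance : IsFiniteMeasure lebesgueUnit :=
  inferInstanceAs (IsFiniteMeasure (volume.restrict (Icc (0 : ℝ) 1)))

variable {f : ℝ → ℝ}

theorem isSublebesgue_iff_exists {μ : Measure ℝ} :
    IsSublebesgue μ ↔ ∃ f, IsSublebesgueDensity f ∧ μ = withUnitDensity f :=
  ⟨fun ⟨f, hf, hf01, hμ⟩ => ⟨f, ⟨hf, hf01⟩, hμ⟩, fun ⟨f, hf, hμ⟩ => ⟨f, hf.1, hf.2, hμ⟩⟩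

theorem IsSublebesgueDensity.one_sub (hf : IsSublebesgueDensity f) :
    IsSublebesgueDensity fun x => 1 - f x :=
  ⟨measurable_const.sub hf.measurable, fun x =>
    ⟨sub_nonneg.mpr (hf.mem_Icc x).2, sub_le_self 1 (hf.mem_Icc x).1⟩⟩

theorem IsSublebesgueDensity.letterFactor (hf : IsSublebesgueDensity f) (b : Bool) :
    IsSublebesgueDensity (letterFactor f b) := by
  cases b
  · exact hf.one_sub
  · exact hf

theorem IsSublebesgueDensity.intervalIntegrable (hf : IsSublebesgueDensity f) (a b : ℝ) :
    IntervalIntegrable f volume a b :=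
  (intervalIntegrable_const (c := (1 : ℝ))).mono_fun hf.measurable.aestronglyMeasurable <|
    ae_of_all _ fun x => by
      simpa [abs_of_nonneg (hf.mem_Icc x).1] using (hf.mem_Icc x).2

theorem IsSublebesgueDensity.integrableOn_Icc (hf : IsSublebesgueDensity f) {a b : ℝ}
    (hab : a ≤ b) : IntegrableOn f (Icc a b) :=
  (intervalIntegrable_iff_integrableOn_Icc_of_le hab).mp (hf.intervalIntegrable a b)

theorem unitDensity_withUnitDensity (hf : IsSublebesgueDensity f) :
    unitDensity (withUnitDensity f) =ᵐ[lebesgueUnit] f := by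
  filter_upwards [Measure.rnDeriv_withDensity lebesgueUnit hf.measurable.ennreal_ofReal] with x hx
  rw [unitDensity, withUnitDensity, hx, ENNReal.toReal_ofReal (hf.mem_Icc x).1]

theorem patternDensity_withUnitDensity_eq_setIntegral {k : ℕ} (w : Fin k → Bool)
    (hf : IsSublebesgueDensity f) :
    patternDensity w (withUnitDensity f) = (k.factorial : ℝ) *
      ∫ x in simplexIn k (Icc 0 1), ∏ i, letterFactor f (w i) (x i) := by
  have hdensity := unitDensity_withUnitDensity hf
  rw [lebesgueUnit, Filter.EventuallyEq, ae_restrict_iff' measurableSet_Icc] at hdensity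
  have hcoord : ∀ᵐ x : Fin k → ℝ, ∀ i, x i ∈ Icc (0 : ℝ) 1 →
      unitDensity (withUnitDensity f) (x i) = f (x i) :=
    ae_all_iff.mpr fun i => (Measure.quasiMeasurePreserving_eval
      (fun _ : Fin k => (volume : Measure ℝ)) i).ae hdensity
  rw [patternDensity]
  congr 1
  refine setIntegral_congr_ae (measurableSet_simplexIn measurableSet_Icc) ?_
  filter_upwards [hcoord] with x hx hmem
  exact Finset.prod_congr rfl fun i _ => by rw [hx i (hmem.2 i), letterFactor]

theorem patternDensity_withUnitDensity {k : ℕ} (w : Fin k → Bool) (hf : IsSublebesgueDensity f) :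
    patternDensity w (withUnitDensity f) =
      (k.factorial : ℝ) * iteratedPrimitive k (fun i => letterFactor f (w i)) 1 := by
  rw [patternDensity_withUnitDensity_eq_setIntegral w hf,
    setIntegral_simplexIn measurableSet_Icc Ico_subset_Icc_self subset_rfl zero_le_one
      fun i => (hf.letterFactor (w i)).integrableOn_Icc zero_le_one]

theorem patternDensity_word1 (hf : IsSublebesgueDensity f) :
    patternDensity word1 (withUnitDensity f) = onesBefore f 1 := by
  rw [patternDensity_withUnitDensity word1 hf]
  simp [iteratedPrimitive, letterFactor, word1, onesBefore]

theorem patternDensity_word1010 (hf : IsSublebesgueDensity f) :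
    patternDensity word1010 (withUnitDensity f) = 24 *
      ∫ x in (0 : ℝ)..1, (1 - f x) * ∫ y in (0 : ℝ)..x, f y *
        ∫ z in (0 : ℝ)..y, (1 - f z) * onesBefore f z := by
  rw [patternDensity_withUnitDensity word1010 hf]
  simp [iteratedPrimitive, letterFactor, word1010, Nat.factorial, Fin.last, onesBefore]

theorem integral_withUnitDensity (hf : IsSublebesgueDensity f) (φ : ℝ → ℝ) :
    ∫ x, φ x ∂withUnitDensity f = ∫ x in (0 : ℝ)..1, f x * φ x := by
  rw [withUnitDensity, integral_withDensity_eq_integral_toReal_smul hf.measurable.ennreal_ofReal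
    (ae_of_all _ fun _ => ENNReal.ofReal_lt_top), lebesgueUnit,
    intervalIntegral.integral_of_le zero_le_one, integral_Icc_eq_integral_Ioc]
  simp only [ENNReal.toReal_ofReal (hf.mem_Icc _).1, smul_eq_mul]

theorem ae_withUnitDensity_mem_Icc : ∀ᵐ x ∂withUnitDensity f, x ∈ Icc (0 : ℝ) 1 :=
  (withDensity_absolutelyContinuous _ _).ae_le (ae_restrict_mem measurableSet_Icc)

end PatternDensity

section MassFunction

variable {f : ℝ → ℝ}

theorem onesBefore_zero (f : ℝ → ℝ) : onesBefore f 0 = 0 := by simp [onesBefore]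

theorem onesBefore_sub (hf : IsSublebesgueDensity f) (x y : ℝ) :
    onesBefore f y - onesBefore f x = ∫ t in x..y, f t :=
  intervalIntegral.integral_interval_sub_left (hf.intervalIntegrable _ _)
    (hf.intervalIntegrable _ _)

theorem onesBefore_sub_mem_Icc (hf : IsSublebesgueDensity f) {x y : ℝ} (hxy : x ≤ y) :
    onesBefore f y - onesBefore f x ∈ Icc 0 (y - x) := by
  rw [onesBefore_sub hf]
  refine ⟨intervalIntegral.integral_nonneg hxy fun t _ => (hf.mem_Icc t).1, ?_⟩
  simpa using intervalIntegral.integral_mono_on (g := fun _ => (1 : ℝ)) hxy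
    (hf.intervalIntegrable x y) intervalIntegrable_const fun t _ => (hf.mem_Icc t).2

theorem monotone_onesBefore (hf : IsSublebesgueDensity f) : Monotone (onesBefore f) :=
  fun _ _ hxy => sub_nonneg.mp (onesBefore_sub_mem_Icc hf hxy).1

theorem continuous_onesBefore (hf : IsSublebesgueDensity f) : Continuous (onesBefore f) :=
  intervalIntegral.continuous_primitive hf.intervalIntegrable 0

theorem onesBefore_mem_Icc (hf : IsSublebesgueDensity f) {x : ℝ} (hx : x ∈ Icc (0 : ℝ) 1) :
    onesBefore f x ∈ Icc 0 (onesBefore f 1) :=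
  ⟨onesBefore_zero f ▸ monotone_onesBefore hf hx.1, monotone_onesBefore hf hx.2⟩

theorem onesBefore_one_mem_Icc (hf : IsSublebesgueDensity f) :
    onesBefore f 1 ∈ Icc (0 : ℝ) 1 := by
  simpa [onesBefore_zero] using onesBefore_sub_mem_Icc hf zero_le_one

theorem zerosAfter_eq (hf : IsSublebesgueDensity f) (x : ℝ) :
    zerosAfter f x = 1 - onesBefore f 1 - x + onesBefore f x := by
  rw [zerosAfter, intervalIntegral.integral_sub intervalIntegrable_const
    (hf.intervalIntegrable _ _), ← onesBefore_sub hf]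
  simp only [integral_one]
  ring

theorem zerosAfter_mem_Icc (hf : IsSublebesgueDensity f) {x : ℝ} (hx : x ∈ Icc (0 : ℝ) 1) :
    zerosAfter f x ∈ Icc 0 (1 - onesBefore f 1) := by
  have hleft := onesBefore_sub_mem_Icc hf hx.1
  have hright := onesBefore_sub_mem_Icc hf hx.2
  rw [onesBefore_zero] at hleft
  rw [zerosAfter_eq hf]
  constructor <;> linarith [hleft.2, hright.2]

theorem continuous_zerosAfter (hf : IsSublebesgueDensity f) : Continuous (zerosAfter f) := by
  have := continuous_onesBefore hf
  rw [funext (zerosAfter_eq hf)]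
  fun_prop

theorem withUnitDensity_Icc (hf : IsSublebesgueDensity f) {y : ℝ} (hy : y ∈ Icc (0 : ℝ) 1) :
    withUnitDensity f (Icc 0 y) = ENNReal.ofReal (onesBefore f y) := by
  rw [withUnitDensity, withDensity_apply _ measurableSet_Icc, lebesgueUnit,
    Measure.restrict_restrict measurableSet_Icc,
    inter_eq_left.mpr (Icc_subset_Icc_right hy.2), onesBefore,
    intervalIntegral.integral_of_le hy.1, ← integral_Icc_eq_integral_Ioc,
    ofReal_integral_eq_lintegral_ofReal (hf.integrableOn_Icc hy.1)
      (ae_of_all _ fun x => (hf.mem_Icc x).1)]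

theorem isFiniteMeasure_withUnitDensity (hf : IsSublebesgueDensity f) :
    IsFiniteMeasure (withUnitDensity f) :=
  isFiniteMeasure_withDensity_ofReal (hf.integrableOn_Icc zero_le_one).2

theorem exists_inter_preimage_Iic_eq_Icc {g : ℝ → ℝ} {a b t : ℝ} (hab : a ≤ b)
    (hmono : MonotoneOn g (Icc a b)) (hcont : ContinuousOn g (Icc a b))
    (ht : t ∈ Icc (g a) (g b)) :
    ∃ y ∈ Icc a b, g y = t ∧ Icc a b ∩ g ⁻¹' Iic t = Icc a y := by
  have hcompact : IsCompact (Icc a b ∩ g ⁻¹' {t}) := isCompact_Icc.of_isClosed_subset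
    (hcont.preimage_isClosed_of_isClosed isClosed_Icc isClosed_singleton) inter_subset_left
  obtain ⟨z, hz, hzt⟩ := intermediate_value_Icc hab hcont ht
  obtain ⟨y, ⟨hy, hyt⟩, hgreatest⟩ := hcompact.exists_isGreatest ⟨z, hz, hzt⟩
  refine ⟨y, hy, hyt, Subset.antisymm (fun x ⟨hx, hxt⟩ => ⟨hx.1, ?_⟩)
    fun x hx => ⟨⟨hx.1, hx.2.trans hy.2⟩, ?_⟩⟩
  · by_contra! hlt
    have hge : t ≤ g x := hyt ▸ hmono hy hx hlt.le
    exact hlt.not_ge (hgreatest ⟨hx, le_antisymm hxt hge⟩)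
  · exact (hmono ⟨hx.1, hx.2.trans hy.2⟩ hy hx.2).trans_eq hyt

theorem measurePreserving_onesBefore (hf : IsSublebesgueDensity f) :
    MeasurePreserving (onesBefore f) (withUnitDensity f)
      (volume.restrict (Icc 0 (onesBefore f 1))) := by
  have := isFiniteMeasure_withUnitDensity hf
  have hcont := continuous_onesBefore hf
  refine ⟨hcont.measurable, Measure.ext_of_Iic _ _ fun t => ?_⟩
  have hset : withUnitDensity f (onesBefore f ⁻¹' Iic t) =
      withUnitDensity f (Icc 0 1 ∩ onesBefore f ⁻¹' Iic t) :=
    measure_congr (ae_withUnitDensity_mem_Icc.mono fun x hx =>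
      propext ⟨fun h => ⟨hx, h⟩, And.right⟩)
  rw [Measure.map_apply hcont.measurable measurableSet_Iic,
    Measure.restrict_apply measurableSet_Iic, hset]
  rcases lt_or_ge t 0 with ht | ht
  · have hempty : Icc 0 1 ∩ onesBefore f ⁻¹' Iic t = ∅ := eq_empty_of_forall_notMem
      fun x ⟨hx, hxt⟩ => (ht.trans_le (onesBefore_mem_Icc hf hx).1).not_ge hxt
    have hempty' : Iic t ∩ Icc 0 (onesBefore f 1) = ∅ := eq_empty_of_forall_notMem
      fun x ⟨hxt, hx⟩ => (ht.trans_le hx.1).not_ge hxt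
    rw [hempty, hempty', measure_empty, measure_empty]
  · obtain ⟨y, hy, hyt, hpre⟩ := exists_inter_preimage_Iic_eq_Icc (t := min (onesBefore f 1) t)
      zero_le_one ((monotone_onesBefore hf).monotoneOn _) hcont.continuousOn
      ⟨(onesBefore_zero f).trans_le (le_min (onesBefore_one_mem_Icc hf).1 ht), min_le_left _ _⟩
    have hmin : Icc 0 1 ∩ onesBefore f ⁻¹' Iic t
        = Icc 0 1 ∩ onesBefore f ⁻¹' Iic (min (onesBefore f 1) t) := by
      ext x
      have := fun hx => (onesBefore_mem_Icc hf (x := x) hx).2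
      simp only [mem_inter_iff, mem_preimage, mem_Iic, le_min_iff]
      tauto
    have hmin' : Iic t ∩ Icc 0 (onesBefore f 1) = Icc 0 (min (onesBefore f 1) t) := by
      ext x
      simp only [mem_inter_iff, mem_Iic, mem_Icc, le_min_iff]
      tauto
    rw [hmin, hpre, hmin', withUnitDensity_Icc hf hy, hyt, Real.volume_Icc, sub_zero]

end MassFunction

section IntegrationByParts

theorem integral_mul_primitive_add {u v : ℝ → ℝ} {a b : ℝ}
    (hu : IntervalIntegrable u volume a b) (hv : IntervalIntegrable v volume a b) :
    (∫ x in a..b, u x * ∫ y in a..x, v y) + (∫ x in a..b, v x * ∫ y in a..x, u y)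
      = (∫ x in a..b, u x) * ∫ x in a..b, v x := by
  have hparts := (hv.absolutelyContinuousOnInterval_intervalIntegral left_mem_uIcc
    ).integral_mul_deriv_eq_deriv_mul
      (hu.absolutelyContinuousOnInterval_intervalIntegral left_mem_uIcc)
  have hU : ∫ x in a..b, (∫ y in a..x, v y) * deriv (fun x => ∫ y in a..x, u y) x
      = ∫ x in a..b, u x * ∫ y in a..x, v y := by
    refine intervalIntegral.integral_congr_ae ?_
    filter_upwards [hu.ae_hasDerivAt_integral] with x hx hxb
    rw [(hx (uIoc_subset_uIcc hxb) a left_mem_uIcc).deriv, mul_comm]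
  have hV : ∫ x in a..b, deriv (fun x => ∫ y in a..x, v y) x * (∫ y in a..x, u y)
      = ∫ x in a..b, v x * ∫ y in a..x, u y := by
    refine intervalIntegral.integral_congr_ae ?_
    filter_upwards [hv.ae_hasDerivAt_integral] with x hx hxb
    rw [(hx (uIoc_subset_uIcc hxb) a left_mem_uIcc).deriv]
  rw [hU, hV] at hparts
  simp only [intervalIntegral.integral_same, zero_mul, sub_zero] at hparts
  linarith

theorem intervalIntegrable_mul_primitive {u v : ℝ → ℝ} {a b : ℝ}
    (hu : IntervalIntegrable u volume a b) (hv : IntervalIntegrable v volume a b) :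
    IntervalIntegrable (fun x => u x * ∫ y in a..x, v y) volume a b :=
  hu.mul_continuousOn (intervalIntegral.continuousOn_primitive_interval' hv left_mem_uIcc)

theorem integral_mul_integral_swap {u v : ℝ → ℝ} {a b : ℝ}
    (hu : IntervalIntegrable u volume a b) (hv : IntervalIntegrable v volume a b) :
    ∫ x in a..b, v x * ∫ y in a..x, u y = ∫ x in a..b, u x * ∫ y in x..b, v y := by
  have htail : ∫ x in a..b, u x * ∫ y in x..b, v y
      = ∫ x in a..b, (u x * (∫ y in a..b, v y) - u x * ∫ y in a..x, v y) := by
    refine intervalIntegral.integral_congr fun x hx => ?_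
    have hax := hv.mono_set (uIcc_subset_uIcc_left hx)
    simp only [← mul_sub, intervalIntegral.integral_interval_sub_left hv hax]
  rw [htail, intervalIntegral.integral_sub (hu.mul_const _)
    (intervalIntegrable_mul_primitive hu hv),
    intervalIntegral.integral_mul_const, ← integral_mul_primitive_add hu hv]
  ring

variable {f : ℝ → ℝ}

theorem integral_one_sub_mul_onesBefore (hf : IsSublebesgueDensity f) (y : ℝ) :
    ∫ z in (0 : ℝ)..y, (1 - f z) * onesBefore f z
      = (∫ t in (0 : ℝ)..y, f t * zerosAfter f t) - onesBefore f y * zerosAfter f y := by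
  have hC := continuous_zerosAfter hf
  have htail : ∀ t, ∫ z in t..y, (1 - f z) = zerosAfter f t - zerosAfter f y := fun t =>
    eq_sub_of_add_eq (intervalIntegral.integral_add_adjacent_intervals
      (hf.one_sub.intervalIntegrable _ _) (hf.one_sub.intervalIntegrable _ _))
  simp only [onesBefore]
  rw [integral_mul_integral_swap (hf.intervalIntegrable _ _) (hf.one_sub.intervalIntegrable _ _)]
  simp only [htail, mul_sub]
  rw [intervalIntegral.integral_sub ((hf.intervalIntegrable _ _).mul_continuousOn hC.continuousOn)
    ((hf.intervalIntegrable _ _).mul_const _), intervalIntegral.integral_mul_const]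

theorem patternDensity_word1010_eq_profileScore (hf : IsSublebesgueDensity f) :
    patternDensity word1010 (withUnitDensity f)
      = 24 * profileScore (withUnitDensity f) (onesBefore f) (zerosAfter f) := by
  have hF := continuous_onesBefore hf
  have hC := continuous_zerosAfter hf
  have hmul : ∀ {φ : ℝ → ℝ}, Continuous φ → ∀ a b,
      IntervalIntegrable (fun x => f x * φ x) volume a b := fun hφ a b =>
    (hf.intervalIntegrable a b).mul_continuousOn hφ.continuousOn
  let U : ℝ → ℝ := fun y => ∫ t in (0 : ℝ)..y, f t * zerosAfter f t
  have hU : Continuous U := intervalIntegral.continuous_primitive (hmul hC) 0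
  have hsquare : ∫ y in (0 : ℝ)..1, f y * zerosAfter f y * U y = U 1 ^ 2 / 2 := by
    linarith [integral_mul_primitive_add (hmul hC 0 1) (hmul hC 0 1)]
  have hswap : ∫ x in (0 : ℝ)..1, (1 - f x) *
        ∫ y in (0 : ℝ)..x, f y * (U y - onesBefore f y * zerosAfter f y)
      = ∫ y in (0 : ℝ)..1, f y * (U y - onesBefore f y * zerosAfter f y) * zerosAfter f y :=
    integral_mul_integral_swap (hmul (hU.sub (hF.mul hC)) 0 1)
      (hf.one_sub.intervalIntegrable _ _)
  simp only [patternDensity_word1010 hf, integral_one_sub_mul_onesBefore hf, profileScore,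
    integral_withUnitDensity hf]
  change 24 * _ = 24 * (U 1 ^ 2 / 2 - _)
  rw [hswap]
  rw [← hsquare, ← intervalIntegral.integral_sub
    ((hmul hC 0 1).mul_continuousOn hU.continuousOn)
    (hmul (φ := fun x => onesBefore f x * zerosAfter f x ^ 2) (hF.mul (hC.pow 2)) 0 1)]
  congr 2 with y
  ring

end IntegrationByParts

section Maximizers

variable {f g : ℝ → ℝ}

theorem twentyfour_mul_sq_div_two (A B : ℝ) :
    24 * ((A * B * Real.exp (-1)) ^ 2 / 2) = 12 / Real.exp 1 ^ 2 * A ^ 2 * B ^ 2 := by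
  rw [Real.exp_neg]
  ring

theorem ae_zerosAfter_mem_Icc (hf : IsSublebesgueDensity f) :
    ∀ᵐ x ∂withUnitDensity f, zerosAfter f x ∈ Icc 0 (1 - onesBefore f 1) :=
  ae_withUnitDensity_mem_Icc.mono fun _ hx => zerosAfter_mem_Icc hf hx

theorem patternDensity_word1010_le (hf : IsSublebesgueDensity f) :
    patternDensity word1010 (withUnitDensity f)
      ≤ 12 / Real.exp 1 ^ 2 * onesBefore f 1 ^ 2 * (1 - onesBefore f 1) ^ 2 := by
  have hmass := onesBefore_one_mem_Icc hf
  rw [patternDensity_word1010_eq_profileScore hf, ← twentyfour_mul_sq_div_two]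
  gcongr
  exact profileScore_le hmass.1 (sub_nonneg.mpr hmass.2) (measurePreserving_onesBefore hf)
    (continuous_zerosAfter hf).aestronglyMeasurable (ae_zerosAfter_mem_Icc hf)

theorem patternDensity_word1010_eq_iff (hf : IsSublebesgueDensity f) :
    patternDensity word1010 (withUnitDensity f)
        = 12 / Real.exp 1 ^ 2 * onesBefore f 1 ^ 2 * (1 - onesBefore f 1) ^ 2 ↔
      ∀ᵐ x ∂withUnitDensity f, zerosAfter f x
        = cutProfile (1 - onesBefore f 1) (onesBefore f 1 * Real.exp (-1)) (onesBefore f x) := by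
  have hmass := onesBefore_one_mem_Icc hf
  rw [patternDensity_word1010_eq_profileScore hf, ← twentyfour_mul_sq_div_two,
    mul_right_inj' (by norm_num), profileScore_eq_iff hmass.1 (sub_nonneg.mpr hmass.2)
      (measurePreserving_onesBefore hf) (continuous_zerosAfter hf).aestronglyMeasurable
      (ae_zerosAfter_mem_Icc hf)]

/-- The position `x` at which a maximizer of total mass `A` has mass `s` before it: the mass of
zeros after `x` is both `cutProfile (1 - A) (A / e) s` and `1 - A - x + s`. -/
noncomputable def maximizerQuantile (A s : ℝ) : ℝ :=
  1 - A + s - cutProfile (1 - A) (A * Real.exp (-1)) s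

theorem withUnitDensity_eq_map_maximizerQuantile (hf : IsSublebesgueDensity f)
    (hmax : patternDensity word1010 (withUnitDensity f)
      = 12 / Real.exp 1 ^ 2 * onesBefore f 1 ^ 2 * (1 - onesBefore f 1) ^ 2) :
    withUnitDensity f =
      (volume.restrict (Icc 0 (onesBefore f 1))).map (maximizerQuantile (onesBefore f 1)) := by
  have hquantile : maximizerQuantile (onesBefore f 1) ∘ onesBefore f
      =ᵐ[withUnitDensity f] id := by
    filter_upwards [(patternDensity_word1010_eq_iff hf).mp hmax] with x hx
    rw [Function.comp_apply, maximizerQuantile, ← hx, zerosAfter_eq hf, id]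
    ring
  have hmeas : Measurable (maximizerQuantile (onesBefore f 1)) := by
    unfold maximizerQuantile
    fun_prop
  rw [← (measurePreserving_onesBefore hf).map_eq,
    Measure.map_map hmeas (continuous_onesBefore hf).measurable, Measure.map_congr hquantile,
    Measure.map_id]

theorem withUnitDensity_eq_of_maximal (hf : IsSublebesgueDensity f)
    (hg : IsSublebesgueDensity g) (hmass : onesBefore f 1 = onesBefore g 1)
    (hfmax : patternDensity word1010 (withUnitDensity f)
      = 12 / Real.exp 1 ^ 2 * onesBefore f 1 ^ 2 * (1 - onesBefore f 1) ^ 2)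
    (hgmax : patternDensity word1010 (withUnitDensity g)
      = 12 / Real.exp 1 ^ 2 * onesBefore g 1 ^ 2 * (1 - onesBefore g 1) ^ 2) :
    withUnitDensity f = withUnitDensity g := by
  rw [withUnitDensity_eq_map_maximizerQuantile hf hfmax,
    withUnitDensity_eq_map_maximizerQuantile hg hgmax, hmass]

end Maximizers

section OptimalDensity

variable {ρ x : ℝ}

theorem isSublebesgueDensity_optimalDensity (h0 : 0 ≤ ρ) (h1 : ρ ≤ 1) :
    IsSublebesgueDensity (optimalDensity ρ) where
  measurable := by
    unfold optimalDensity
    refine Measurable.ite measurableSet_Iio measurable_const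
      (Measurable.ite measurableSet_Iic ?_ measurable_const)
    fun_prop
  mem_Icc x := by
    unfold optimalDensity
    split_ifs
    · simp
    · have hratio : |Real.exp (1 / 2) * (x + ρ - 1) /
          √(4 * ρ * (1 - ρ) + Real.exp 1 * (x + ρ - 1) ^ 2)| ≤ 1 := by
        rw [abs_div, abs_of_nonneg (Real.sqrt_nonneg _)]
        refine div_le_one_of_le₀ (Real.abs_le_sqrt ?_) (Real.sqrt_nonneg _)
        rw [mul_pow, Real.exp_half, Real.sq_sqrt (Real.exp_nonneg 1)]
        exact le_add_of_nonneg_left (mul_nonneg (by positivity) (sub_nonneg.mpr h1))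
      obtain ⟨hlow, hhigh⟩ := abs_le.mp hratio
      constructor <;> linarith
    · simp

theorem optimalDensity_of_lt (hx : x < ρ / Real.exp 1) : optimalDensity ρ x = 1 := if_pos hx

theorem div_exp_one_le_one_sub (ρ : ℝ) : ρ / Real.exp 1 ≤ 1 - (1 - ρ) / Real.exp 1 := by
  have hsum : ρ / Real.exp 1 + (1 - ρ) / Real.exp 1 = 1 / Real.exp 1 := by ring
  have hle : 1 / Real.exp 1 ≤ 1 := div_le_self zero_le_one (Real.one_le_exp zero_le_one)
  linarith

theorem one_sub_div_exp_one_le_one (h1 : ρ ≤ 1) : 1 - (1 - ρ) / Real.exp 1 ≤ 1 :=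
  sub_le_self _ (div_nonneg (sub_nonneg.mpr h1) (Real.exp_nonneg 1))

theorem optimalDensity_of_gt (hx : 1 - (1 - ρ) / Real.exp 1 < x) : optimalDensity ρ x = 0 := by
  rw [optimalDensity, if_neg ((div_exp_one_le_one_sub ρ).trans hx.le).not_gt, if_neg hx.not_ge]

/-- The primitive of the optimal density on its middle interval: the positive root `s` of
`s * (1 - ρ - x + s) = ρ * (1 - ρ) / e`. -/
noncomputable def optimalCurve (ρ x : ℝ) : ℝ :=
  ((x + ρ - 1) + √((x + ρ - 1) ^ 2 + 4 * ρ * (1 - ρ) / Real.exp 1)) / 2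

theorem continuous_optimalCurve (ρ : ℝ) : Continuous (optimalCurve ρ) := by
  unfold optimalCurve
  fun_prop

theorem optimalCurve_left (h0 : 0 ≤ ρ) (h1 : ρ ≤ 1) :
    optimalCurve ρ (ρ / Real.exp 1) = ρ / Real.exp 1 := by
  have hroot : (ρ / Real.exp 1 + ρ - 1) ^ 2 + 4 * ρ * (1 - ρ) / Real.exp 1
      = ((1 - ρ) + ρ / Real.exp 1) ^ 2 := by
    field_simp
    ring
  have : 0 ≤ 1 - ρ := sub_nonneg.mpr h1
  rw [optimalCurve, hroot, Real.sqrt_sq (by positivity)]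
  ring

theorem optimalCurve_right (h0 : 0 ≤ ρ) (h1 : ρ ≤ 1) :
    optimalCurve ρ (1 - (1 - ρ) / Real.exp 1) = ρ := by
  have hroot : (1 - (1 - ρ) / Real.exp 1 + ρ - 1) ^ 2 + 4 * ρ * (1 - ρ) / Real.exp 1
      = (ρ + (1 - ρ) / Real.exp 1) ^ 2 := by
    field_simp
    ring
  have : 0 ≤ 1 - ρ := sub_nonneg.mpr h1
  rw [optimalCurve, hroot, Real.sqrt_sq (by positivity)]
  ring

theorem optimalCurve_mul (h0 : 0 ≤ ρ) (h1 : ρ ≤ 1) (x : ℝ) :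
    optimalCurve ρ x * (1 - ρ - x + optimalCurve ρ x) = (1 - ρ) * (ρ / Real.exp 1) := by
  have : 0 ≤ 1 - ρ := sub_nonneg.mpr h1
  have hsqrt :=
    Real.sq_sqrt (show 0 ≤ (x + ρ - 1) ^ 2 + 4 * ρ * (1 - ρ) / Real.exp 1 by positivity)
  unfold optimalCurve
  linear_combination hsqrt / 4

theorem optimalCurve_radicand_pos (h0 : 0 ≤ ρ) (h1 : ρ ≤ 1)
    (hx : x ∈ Ioo (ρ / Real.exp 1) (1 - (1 - ρ) / Real.exp 1)) :
    0 < (x + ρ - 1) ^ 2 + 4 * ρ * (1 - ρ) / Real.exp 1 := by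
  have : 0 ≤ 1 - ρ := sub_nonneg.mpr h1
  rcases eq_or_ne (x + ρ - 1) 0 with hzero | hne
  · have hpos : 0 < ρ := by
      have : 0 ≤ (1 - ρ) / Real.exp 1 := by positivity
      linarith [hx.2]
    have hlt : 0 < 1 - ρ := by
      have : 0 ≤ ρ / Real.exp 1 := by positivity
      linarith [hx.1]
    positivity
  · positivity

theorem hasDerivAt_optimalCurve (h0 : 0 ≤ ρ) (h1 : ρ ≤ 1)
    (hx : x ∈ Ioo (ρ / Real.exp 1) (1 - (1 - ρ) / Real.exp 1)) :
    HasDerivAt (optimalCurve ρ) (optimalDensity ρ x) x := by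
  have hpos := optimalCurve_radicand_pos h0 h1 hx
  have hlin : HasDerivAt (fun x : ℝ => x + ρ - 1) 1 x :=
    ((hasDerivAt_id x).add_const ρ).sub_const 1
  have hsqrt := ((hlin.pow 2).add_const (4 * ρ * (1 - ρ) / Real.exp 1)).sqrt hpos.ne'
  refine ((hlin.add hsqrt).div_const 2).congr_deriv ?_
  have hscale : 4 * ρ * (1 - ρ) + Real.exp 1 * (x + ρ - 1) ^ 2
      = Real.exp 1 * ((x + ρ - 1) ^ 2 + 4 * ρ * (1 - ρ) / Real.exp 1) := by
    field_simp
    ring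
  rw [optimalDensity, if_neg hx.1.not_gt, if_pos hx.2.le, hscale,
    Real.sqrt_mul (Real.exp_nonneg 1), Real.exp_half]
  have := Real.sqrt_pos.mpr (Real.exp_pos 1)
  have := Real.sqrt_pos.mpr hpos
  simp only [Pi.pow_apply]
  field_simp
  ring

theorem onesBefore_optimalDensity_left (h0 : 0 ≤ ρ) (h1 : ρ ≤ 1)
    (hx : x ∈ Icc 0 (ρ / Real.exp 1)) : onesBefore (optimalDensity ρ) x = x := by
  have hftc := intervalIntegral.integral_eq_sub_of_hasDeriv_right_of_le hx.1 continuousOn_id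
    (fun y hy => (optimalDensity_of_lt (hy.2.trans_le hx.2)).symm ▸
      (hasDerivAt_id y).hasDerivWithinAt)
    ((isSublebesgueDensity_optimalDensity h0 h1).intervalIntegrable _ _)
  simpa [onesBefore] using hftc

theorem onesBefore_optimalDensity_middle (h0 : 0 ≤ ρ) (h1 : ρ ≤ 1)
    (hx : x ∈ Icc (ρ / Real.exp 1) (1 - (1 - ρ) / Real.exp 1)) :
    onesBefore (optimalDensity ρ) x = optimalCurve ρ x := by
  have hf := isSublebesgueDensity_optimalDensity h0 h1
  have hftc := intervalIntegral.integral_eq_sub_of_hasDeriv_right_of_le hx.1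
    (continuous_optimalCurve ρ).continuousOn (fun y hy =>
      (hasDerivAt_optimalCurve h0 h1 ⟨hy.1, hy.2.trans_le hx.2⟩).hasDerivWithinAt)
    (hf.intervalIntegrable _ _)
  rw [← onesBefore_sub hf, onesBefore_optimalDensity_left h0 h1 ⟨by positivity, le_rfl⟩,
    optimalCurve_left h0 h1] at hftc
  exact sub_left_injective hftc

theorem onesBefore_optimalDensity_one (h0 : 0 ≤ ρ) (h1 : ρ ≤ 1) :
    onesBefore (optimalDensity ρ) 1 = ρ := by
  have hf := isSublebesgueDensity_optimalDensity h0 h1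
  have hftc := intervalIntegral.integral_eq_sub_of_hasDeriv_right_of_le
    (one_sub_div_exp_one_le_one h1) (f := fun _ => (0 : ℝ)) continuousOn_const
    (fun y hy => (optimalDensity_of_gt hy.1).symm ▸ (hasDerivAt_const y (0 : ℝ)).hasDerivWithinAt)
    (hf.intervalIntegrable _ _)
  rwa [← onesBefore_sub hf, sub_self,
    onesBefore_optimalDensity_middle h0 h1 ⟨div_exp_one_le_one_sub ρ, le_rfl⟩,
    optimalCurve_right h0 h1, sub_eq_zero] at hftc

theorem zerosAfter_optimalDensity (h0 : 0 < ρ) (h1 : ρ ≤ 1)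
    (hx : x ∈ Icc 0 (1 - (1 - ρ) / Real.exp 1)) :
    zerosAfter (optimalDensity ρ) x
      = cutProfile (1 - ρ) (ρ / Real.exp 1) (onesBefore (optimalDensity ρ) x) := by
  have hf := isSublebesgueDensity_optimalDensity h0.le h1
  have hk : 0 < ρ / Real.exp 1 := by positivity
  rw [zerosAfter_eq hf, onesBefore_optimalDensity_one h0.le h1]
  rcases le_total x (ρ / Real.exp 1) with hle | hge
  · rw [onesBefore_optimalDensity_left h0.le h1 ⟨hx.1, hle⟩, cutProfile_of_le hk hle]
    ring
  · have hcurve := monotone_onesBefore hf hge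
    rw [onesBefore_optimalDensity_left h0.le h1 ⟨hk.le, le_rfl⟩,
      onesBefore_optimalDensity_middle h0.le h1 ⟨hge, hx.2⟩] at hcurve
    rw [onesBefore_optimalDensity_middle h0.le h1 ⟨hge, hx.2⟩, cutProfile_of_ge hcurve,
      eq_div_iff (hk.trans_le hcurve).ne', mul_comm, optimalCurve_mul h0.le h1]

theorem ae_withUnitDensity_optimalDensity_le (h0 : 0 ≤ ρ) (h1 : ρ ≤ 1) :
    ∀ᵐ x ∂withUnitDensity (optimalDensity ρ), x ≤ 1 - (1 - ρ) / Real.exp 1 := by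
  refine (ae_withDensity_iff
    (isSublebesgueDensity_optimalDensity h0 h1).measurable.ennreal_ofReal).mpr
    (ae_of_all _ fun x hx => ?_)
  by_contra! hlt
  exact hx (by rw [optimalDensity_of_gt hlt, ENNReal.ofReal_zero])

theorem patternDensity_word1010_optimalDensity (h0 : 0 ≤ ρ) (h1 : ρ ≤ 1) :
    patternDensity word1010 (withUnitDensity (optimalDensity ρ))
      = 12 / Real.exp 1 ^ 2 * ρ ^ 2 * (1 - ρ) ^ 2 := by
  have hf := isSublebesgueDensity_optimalDensity h0 h1
  have hmax := patternDensity_word1010_eq_iff hf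
  have hmp := measurePreserving_onesBefore hf
  have hzeros := ae_zerosAfter_mem_Icc hf
  simp only [onesBefore_optimalDensity_one h0 h1] at hmax hmp hzeros
  rw [hmax]
  rcases h0.eq_or_lt with rfl | hpos
  · exact ae_eq_cutProfile_of_mul_eq_zero hmp hzeros (zero_mul _)
  · filter_upwards [ae_withUnitDensity_optimalDensity_le h0 h1, ae_withUnitDensity_mem_Icc]
      with x hle hx
    rw [zerosAfter_optimalDensity hpos h1 ⟨hx.1, hle⟩, Real.exp_neg, div_eq_mul_inv]

theorem mem_sublebesgueWithMass_iff {μ : Measure ℝ} : μ ∈ sublebesgueWithMass ρ ↔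
    ∃ f, IsSublebesgueDensity f ∧ onesBefore f 1 = ρ ∧ μ = withUnitDensity f := by
  rw [sublebesgueWithMass, mem_ofPred_eq, isSublebesgue_iff_exists]
  constructor
  · rintro ⟨⟨f, hf, rfl⟩, hmass⟩
    exact ⟨f, hf, (patternDensity_word1 hf).symm.trans hmass, rfl⟩
  · rintro ⟨f, hf, hmass, rfl⟩
    exact ⟨⟨f, hf, rfl⟩, (patternDensity_word1 hf).trans hmass⟩

theorem withUnitDensity_optimalDensity_mem (h0 : 0 ≤ ρ) (h1 : ρ ≤ 1) :
    withUnitDensity (optimalDensity ρ) ∈ sublebesgueWithMass ρ :=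
  mem_sublebesgueWithMass_iff.mpr ⟨_, isSublebesgueDensity_optimalDensity h0 h1,
    onesBefore_optimalDensity_one h0 h1, rfl⟩

theorem isGreatest_patternDensity_word1010 (h0 : 0 ≤ ρ) (h1 : ρ ≤ 1) :
    IsGreatest (patternDensity word1010 '' sublebesgueWithMass ρ)
      (12 / Real.exp 1 ^ 2 * ρ ^ 2 * (1 - ρ) ^ 2) := by
  refine ⟨⟨_, withUnitDensity_optimalDensity_mem h0 h1,
    patternDensity_word1010_optimalDensity h0 h1⟩, ?_⟩
  rintro _ ⟨μ, hμ, rfl⟩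
  obtain ⟨f, hf, rfl, rfl⟩ := mem_sublebesgueWithMass_iff.mp hμ
  exact patternDensity_word1010_le hf

theorem eq_withUnitDensity_optimalDensity_of_maximal {ν : Measure ℝ}
    (hν : ν ∈ sublebesgueWithMass ρ)
    (hmax : patternDensity word1010 ν = 12 / Real.exp 1 ^ 2 * ρ ^ 2 * (1 - ρ) ^ 2) :
    ν = withUnitDensity (optimalDensity ρ) := by
  obtain ⟨f, hf, rfl, rfl⟩ := mem_sublebesgueWithMass_iff.mp hν
  obtain ⟨h0, h1⟩ := onesBefore_one_mem_Icc hf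
  have hone := onesBefore_optimalDensity_one h0 h1
  exact withUnitDensity_eq_of_maximal hf (isSublebesgueDensity_optimalDensity h0 h1) hone.symm hmax
    (by rw [hone, patternDensity_word1010_optimalDensity h0 h1])

end OptimalDensity

section Stability

variable {k : ℕ} {u v : Fin k → ℝ → ℝ} {ε t : ℝ}

theorem continuous_iteratedPrimitive (hu : ∀ i, IsSublebesgueDensity (u i)) :
    Continuous (iteratedPrimitive k u) := by
  induction k with
  | zero => exact continuous_const
  | succ k ih =>
    exact intervalIntegral.continuous_primitive (fun a b =>
      ((hu _).intervalIntegrable a b).mul_continuousOn (ih fun i => hu _).continuousOn) 0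

theorem iteratedPrimitive_mem_Icc (hu : ∀ i, IsSublebesgueDensity (u i))
    (ht : t ∈ Icc (0 : ℝ) 1) : iteratedPrimitive k u t ∈ Icc (0 : ℝ) 1 := by
  induction k generalizing t with
  | zero => exact ⟨zero_le_one, le_rfl⟩
  | succ k ih =>
    have hmem : ∀ s ∈ Icc 0 t, iteratedPrimitive k (fun i => u i.castSucc) s ∈ Icc (0 : ℝ) 1 :=
      fun s hs => ih (fun i => hu _) ⟨hs.1, hs.2.trans ht.2⟩
    have hint := ((hu (Fin.last k)).intervalIntegrable 0 t).mul_continuousOn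
      (continuous_iteratedPrimitive fun i => hu i.castSucc).continuousOn
    refine ⟨intervalIntegral.integral_nonneg ht.1 fun s hs =>
      mul_nonneg ((hu _).mem_Icc s).1 (hmem s hs).1, ?_⟩
    have hle := intervalIntegral.integral_mono_on (g := fun _ => (1 : ℝ)) ht.1 hint
      intervalIntegrable_const fun s hs =>
        mul_le_one₀ ((hu _).mem_Icc s).2 (hmem s hs).1 (hmem s hs).2
    exact hle.trans (by simpa using ht.2)

theorem abs_integral_le_of_abs_le {g : ℝ → ℝ} (ht : t ∈ Icc (0 : ℝ) 1) (hε : 0 ≤ ε)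
    (hg : ∀ s ∈ Icc (0 : ℝ) 1, |g s| ≤ ε) : |∫ s in (0 : ℝ)..t, g s| ≤ ε := by
  have hle : |∫ s in (0 : ℝ)..t, g s| ≤ ε * |t - 0| :=
    intervalIntegral.norm_integral_le_of_norm_le_const (f := g) fun s hs =>
      hg s (Ioc_subset_Icc_self (Ioc_subset_Ioc_right ht.2 (uIoc_of_le ht.1 ▸ hs)))
  rw [sub_zero, abs_of_nonneg ht.1] at hle
  exact hle.trans (mul_le_of_le_one_right hε ht.2)

theorem abs_integral_mul_primitive_le {w g : ℝ → ℝ} (ht : t ∈ Icc (0 : ℝ) 1)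
    (hw : IntervalIntegrable w volume 0 t) (hg : IntervalIntegrable g volume 0 t)
    (hprim : ∀ s ∈ Icc (0 : ℝ) 1, |∫ y in (0 : ℝ)..s, w y| ≤ ε)
    (hbound : ∀ s ∈ Icc (0 : ℝ) 1, |g s| ≤ 1) :
    |∫ s in (0 : ℝ)..t, w s * ∫ y in (0 : ℝ)..s, g y| ≤ 2 * ε := by
  have hε : 0 ≤ ε := (abs_nonneg _).trans (hprim t ht)
  have hboundary : |(∫ s in (0 : ℝ)..t, w s) * ∫ s in (0 : ℝ)..t, g s| ≤ ε := by
    rw [abs_mul, ← mul_one ε]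
    gcongr
    · exact hprim t ht
    · exact abs_integral_le_of_abs_le ht zero_le_one hbound
  have hbulk : |∫ s in (0 : ℝ)..t, g s * ∫ y in (0 : ℝ)..s, w y| ≤ ε := by
    refine abs_integral_le_of_abs_le ht hε fun s hs => ?_
    rw [abs_mul, ← one_mul ε]
    gcongr
    · exact hbound s hs
    · exact hprim s hs
  rw [eq_sub_of_add_eq (integral_mul_primitive_add hw hg), two_mul]
  exact (abs_sub _ _).trans (add_le_add hboundary hbulk)

theorem abs_integral_mul_iteratedPrimitive_le {w : ℝ → ℝ} (hu : ∀ i, IsSublebesgueDensity (u i))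
    (ht : t ∈ Icc (0 : ℝ) 1) (hw : IntervalIntegrable w volume 0 t)
    (hprim : ∀ s ∈ Icc (0 : ℝ) 1, |∫ y in (0 : ℝ)..s, w y| ≤ ε) :
    |∫ s in (0 : ℝ)..t, w s * iteratedPrimitive k u s| ≤ 2 * ε := by
  cases k with
  | zero =>
    have := hprim t ht
    simp only [iteratedPrimitive, mul_one]
    linarith [abs_nonneg (∫ y in (0 : ℝ)..t, w y)]
  | succ k =>
    refine abs_integral_mul_primitive_le ht hw
      (((hu _).intervalIntegrable 0 t).mul_continuousOn
        (continuous_iteratedPrimitive fun i => hu i.castSucc).continuousOn) hprim fun s hs => ?_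
    have hlast := (hu (Fin.last k)).mem_Icc s
    have hinit := iteratedPrimitive_mem_Icc (fun i => hu i.castSucc) hs
    rw [abs_of_nonneg (mul_nonneg hlast.1 hinit.1)]
    exact mul_le_one₀ hlast.2 hinit.1 hinit.2

theorem integral_mul_sub_integral_mul {a b : ℝ} {p q P Q : ℝ → ℝ}
    (hp : IntervalIntegrable p volume a b) (hq : IntervalIntegrable q volume a b)
    (hP : Continuous P) (hQ : Continuous Q) :
    (∫ s in a..b, p s * P s) - ∫ s in a..b, q s * Q s
      = (∫ s in a..b, p s * (P s - Q s)) + ∫ s in a..b, (p s - q s) * Q s := by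
  have hPQ : Continuous fun s => P s - Q s := hP.sub hQ
  rw [← intervalIntegral.integral_sub (hp.mul_continuousOn hP.continuousOn)
      (hq.mul_continuousOn hQ.continuousOn),
    ← intervalIntegral.integral_add (hp.mul_continuousOn hPQ.continuousOn)
      ((hp.sub hq).mul_continuousOn hQ.continuousOn)]
  congr 1 with s
  ring

theorem abs_iteratedPrimitive_sub_le (hu : ∀ i, IsSublebesgueDensity (u i))
    (hv : ∀ i, IsSublebesgueDensity (v i))
    (hε : ∀ i, ∀ s ∈ Icc (0 : ℝ) 1, |onesBefore (u i) s - onesBefore (v i) s| ≤ ε)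
    (ht : t ∈ Icc (0 : ℝ) 1) :
    |iteratedPrimitive k u t - iteratedPrimitive k v t| ≤ 2 * k * ε := by
  induction k generalizing t with
  | zero => simp [iteratedPrimitive]
  | succ k ih =>
    set U := iteratedPrimitive k fun i => u i.castSucc
    set V := iteratedPrimitive k fun i => v i.castSucc
    have hU : Continuous U := continuous_iteratedPrimitive fun i => hu _
    have hV : Continuous V := continuous_iteratedPrimitive fun i => hv _
    have hul := (hu (Fin.last k)).intervalIntegrable
    have hvl := (hv (Fin.last k)).intervalIntegrable
    have hUV : ∀ s ∈ Icc (0 : ℝ) 1, |U s - V s| ≤ 2 * k * ε := fun s hs =>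
      ih (fun i => hu _) (fun i => hv _) (fun i => hε _) hs
    have htail : |∫ s in (0 : ℝ)..t, u (Fin.last k) s * (U s - V s)| ≤ 2 * k * ε := by
      refine abs_integral_le_of_abs_le ht ((abs_nonneg _).trans (hUV t ht)) fun s hs => ?_
      have hmem := (hu (Fin.last k)).mem_Icc s
      rw [abs_mul, abs_of_nonneg hmem.1]
      exact (mul_le_of_le_one_left (abs_nonneg _) hmem.2).trans (hUV s hs)
    have hlast : |∫ s in (0 : ℝ)..t, (u (Fin.last k) s - v (Fin.last k) s) * V s| ≤ 2 * ε := by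
      refine abs_integral_mul_iteratedPrimitive_le (fun i => hv _) ht ((hul 0 t).sub (hvl 0 t))
        fun s hs => ?_
      rw [intervalIntegral.integral_sub (hul 0 s) (hvl 0 s)]
      exact hε _ s hs
    rw [iteratedPrimitive, iteratedPrimitive,
      integral_mul_sub_integral_mul (hul 0 t) (hvl 0 t) hU hV]
    push_cast
    linarith [abs_add_le (∫ s in (0 : ℝ)..t, u (Fin.last k) s * (U s - V s))
      (∫ s in (0 : ℝ)..t, (u (Fin.last k) s - v (Fin.last k) s) * V s)]

theorem onesBefore_one_sub {f : ℝ → ℝ} (hf : IsSublebesgueDensity f) (s : ℝ) :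
    onesBefore (fun x => 1 - f x) s = s - onesBefore f s := by
  rw [onesBefore, intervalIntegral.integral_sub intervalIntegrable_const
    (hf.intervalIntegrable _ _)]
  simp [onesBefore]

theorem abs_patternDensity_sub_le {f g : ℝ → ℝ} (hf : IsSublebesgueDensity f)
    (hg : IsSublebesgueDensity g)
    (hε : ∀ s ∈ Icc (0 : ℝ) 1, |onesBefore f s - onesBefore g s| ≤ ε) (w : Fin k → Bool) :
    |patternDensity w (withUnitDensity f) - patternDensity w (withUnitDensity g)|
      ≤ k.factorial * (2 * k * ε) := by
  have hletter : ∀ b, ∀ s ∈ Icc (0 : ℝ) 1,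
      |onesBefore (letterFactor f b) s - onesBefore (letterFactor g b) s| ≤ ε := by
    intro b s hs
    cases b
    · change |onesBefore (fun x => 1 - f x) s - onesBefore (fun x => 1 - g x) s| ≤ ε
      rw [onesBefore_one_sub hf, onesBefore_one_sub hg, sub_sub_sub_cancel_left, abs_sub_comm]
      exact hε s hs
    · exact hε s hs
  rw [patternDensity_withUnitDensity w hf, patternDensity_withUnitDensity w hg, ← mul_sub,
    abs_mul, Nat.abs_cast]
  gcongr
  exact abs_iteratedPrimitive_sub_le (fun i => hf.letterFactor _) (fun i => hg.letterFactor _)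
    (fun i => hletter (w i)) (right_mem_Icc.mpr zero_le_one)

end Stability

section DeckDensity

variable {N k : ℕ}

/-- The product of the cells `[eᵢ/N, (eᵢ+1)/N)`. -/
def cellBox (e : Fin k → Fin N) : Set (Fin k → ℝ) :=
  univ.pi fun i => Ico ((e i : ℝ) / N) ((e i + 1) / N)

theorem Ico_div_subset_Ico (j : Fin N) :
    Ico ((j : ℝ) / N) ((j + 1) / N) ⊆ Ico 0 1 :=
  Ico_subset_Ico (by positivity) (div_le_one_of_le₀ (mod_cast j.isLt) (Nat.cast_nonneg N))

theorem measurableSet_cellBox (e : Fin k → Fin N) : MeasurableSet (cellBox e) :=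
  .univ_pi fun _ => measurableSet_Ico

theorem volume_real_cellBox (e : Fin k → Fin N) :
    volume.real (cellBox e) = 1 / (N : ℝ) ^ k := by
  rw [Measure.real, cellBox,
    Real.volume_pi_Ico_toReal fun i => by dsimp only; gcongr; linarith]
  simp [← sub_div]

variable [NeZero N]

/-- The index `j` of the cell `[j/N, (j+1)/N)` containing `x ∈ [0,1)`; the truncation at `N - 1`
keeps the function total and monotone. -/
noncomputable def cellIndex (N : ℕ) [NeZero N] (x : ℝ) : Fin N :=
  ⟨min ⌊N * x⌋₊ (N - 1), by have := NeZero.pos N; lia⟩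

/-- The step density of a deck: `1` on the cells of the ones of `X` and `0` elsewhere. -/
noncomputable def deckDensity (X : Fin N → Bool) (x : ℝ) : ℝ := if X (cellIndex N x) then 1 else 0

theorem monotone_cellIndex : Monotone (cellIndex N) := fun x y hxy => by
  rw [cellIndex, cellIndex, Fin.mk_le_mk]
  gcongr

theorem cellIndex_eq_iff {x : ℝ} (hx : x ∈ Ico (0 : ℝ) 1) {j : Fin N} :
    cellIndex N x = j ↔ x ∈ Ico ((j : ℝ) / N) ((j + 1) / N) := by
  have hN : (0 : ℝ) < N := mod_cast NeZero.pos N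
  have hfloor : ⌊N * x⌋₊ < N :=
    (Nat.floor_lt (mul_nonneg hN.le hx.1)).mpr (mul_lt_of_lt_one_right hN hx.2)
  have hmin : (cellIndex N x : ℕ) = ⌊N * x⌋₊ := min_eq_left (Nat.le_sub_one_of_lt hfloor)
  rw [Fin.ext_iff, hmin, Nat.floor_eq_iff (mul_nonneg hN.le hx.1), mem_Ico, div_le_iff₀' hN,
    lt_div_iff₀' hN]

theorem isSublebesgueDensity_deckDensity (X : Fin N → Bool) :
    IsSublebesgueDensity (deckDensity X) where
  measurable := (measurable_of_finite fun j => if X j then (1 : ℝ) else 0).comp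
    monotone_cellIndex.measurable
  mem_Icc x := by
    rw [deckDensity]
    split_ifs <;> simp

theorem prod_letterFactor_deckDensity (X : Fin N → Bool) (w : Fin k → Bool) (x : Fin k → ℝ) :
    ∏ i, letterFactor (deckDensity X) (w i) (x i)
      = {x | ∀ i, X (cellIndex N (x i)) = w i}.indicator 1 x := by
  have hletter : ∀ b y, letterFactor (deckDensity X) b y
      = if X (cellIndex N y) = b then 1 else 0 := by
    intro b y
    cases b <;> cases hy : X (cellIndex N y) <;> simp [letterFactor, deckDensity, hy]
  simp only [hletter, Fintype.prod_ite_zero, Finset.prod_const_one, indicator_apply,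
    mem_ofPred_eq, Pi.one_apply]

/-- Two points of one cell carry the same letter, so consecutive distinct letters force an
increasing tuple into distinct cells. -/
theorem simplexIn_inter_eq_iUnion (X : Fin N → Bool) {w : Fin (k + 1) → Bool}
    (hw : ∀ i : Fin k, w i.castSucc ≠ w i.succ) :
    simplexIn (k + 1) (Ico 0 1) ∩ {x | ∀ i, X (cellIndex N (x i)) = w i}
      = ⋃ e : {e : Fin (k + 1) ↪o Fin N // ∀ i, X (e i) = w i}, cellBox e.1 := by
  ext x
  simp only [cellBox, mem_inter_iff, mem_iUnion, mem_univ_pi, mem_ofPred_eq]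
  constructor
  · rintro ⟨⟨hx, hx01⟩, hX⟩
    have hstrict : StrictMono fun i => cellIndex N (x i) :=
      Fin.strictMono_iff_lt_succ.mpr fun i =>
        (monotone_cellIndex (hx.monotone (Fin.castSucc_lt_succ (i := i)).le)).lt_of_ne fun h =>
          hw i (by rw [← hX, ← hX, h])
    exact ⟨⟨OrderEmbedding.ofStrictMono _ hstrict, hX⟩,
      fun i => (cellIndex_eq_iff (hx01 i)).mp rfl⟩
  · rintro ⟨⟨e, he⟩, hx⟩
    have hx01 : ∀ i, x i ∈ Ico (0 : ℝ) 1 := fun i => Ico_div_subset_Ico _ (hx i)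
    have hcell : ∀ i, cellIndex N (x i) = e i := fun i => (cellIndex_eq_iff (hx01 i)).mpr (hx i)
    refine ⟨⟨fun i j hij => (monotone_cellIndex (N := N)).reflect_lt ?_, hx01⟩,
      fun i => hcell i ▸ he i⟩
    rw [hcell, hcell]
    exact e.strictMono hij

theorem pairwise_disjoint_cellBox :
    Pairwise (Function.onFun Disjoint (cellBox : (Fin k → Fin N) → Set (Fin k → ℝ))) := by
  intro e e' hne
  refine disjoint_left.mpr fun x hx hx' => hne (funext fun i => ?_)
  have hxi := hx i (mem_univ i)
  have hx01 := Ico_div_subset_Ico _ hxi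
  rw [← (cellIndex_eq_iff hx01).mpr hxi, (cellIndex_eq_iff hx01).mpr (hx' i (mem_univ i))]

theorem volume_real_simplexIn_inter (X : Fin N → Bool) {w : Fin (k + 1) → Bool}
    (hw : ∀ i : Fin k, w i.castSucc ≠ w i.succ) :
    volume.real (simplexIn (k + 1) (Ico 0 1) ∩ {x | ∀ i, X (cellIndex N (x i)) = w i})
      = patternCount w X / (N : ℝ) ^ (k + 1) := by
  have hdisj : Pairwise (Function.onFun Disjoint
      fun e : {e : Fin (k + 1) ↪o Fin N // ∀ i, X (e i) = w i} => cellBox e.1) :=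
    fun _ _ hne => pairwise_disjoint_cellBox fun h => hne (Subtype.ext (DFunLike.coe_injective h))
  have hfin : ∀ e : Fin (k + 1) → Fin N, volume (cellBox e) ≠ ⊤ := fun e =>
    (Bornology.IsBounded.pi fun i => Metric.isBounded_Ico _ _).measure_lt_top.ne
  rw [simplexIn_inter_eq_iUnion X hw, measureReal_iUnion_fintype hdisj
    (fun e => measurableSet_cellBox e.1) fun e => hfin e.1]
  simp only [volume_real_cellBox, Finset.sum_const, Finset.card_univ, nsmul_eq_mul, patternCount,
    Nat.card_eq_fintype_card, mul_one_div]

theorem patternDensity_deckDensity (X : Fin N → Bool) {w : Fin (k + 1) → Bool}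
    (hw : ∀ i : Fin k, w i.castSucc ≠ w i.succ) :
    patternDensity w (withUnitDensity (deckDensity X))
      = (k + 1).factorial * (patternCount w X / (N : ℝ) ^ (k + 1)) := by
  have hX := isSublebesgueDensity_deckDensity X
  have hletter := fun i => (hX.letterFactor (w i)).integrableOn_Icc zero_le_one
  have hmatch : MeasurableSet {x : Fin (k + 1) → ℝ | ∀ i, X (cellIndex N (x i)) = w i} := by
    have := (monotone_cellIndex (N := N)).measurable
    measurability
  rw [patternDensity_withUnitDensity w hX, ← setIntegral_simplexIn measurableSet_Ico subset_rfl
    Ico_subset_Icc_self zero_le_one hletter]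
  simp only [prod_letterFactor_deckDensity]
  rw [setIntegral_indicator hmatch]
  simp only [Pi.one_apply, setIntegral_const, smul_eq_mul, mul_one]
  rw [volume_real_simplexIn_inter X hw]

theorem wordDensity_eq_patternDensity_mul (X : Fin N → Bool) {w : Fin (k + 1) → Bool}
    (hw : ∀ i : Fin k, w i.castSucc ≠ w i.succ) :
    wordDensity w X = patternDensity w (withUnitDensity (deckDensity X))
      * ((N : ℝ) ^ (k + 1) / ((k + 1).factorial * N.choose (k + 1))) := by
  have hN : (N : ℝ) ≠ 0 := mod_cast NeZero.ne N
  rw [wordDensity, patternDensity_deckDensity X hw]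
  field_simp

theorem onesBefore_deckDensity_succ (X : Fin N → Bool) (j : Fin N) :
    onesBefore (deckDensity X) ((j + 1) / N)
      = onesBefore (deckDensity X) (j / N) + (if X j then 1 else 0) / N := by
  have hle : (j : ℝ) / N ≤ (j + 1) / N := by gcongr; linarith
  rw [← sub_eq_iff_eq_add', onesBefore_sub (isSublebesgueDensity_deckDensity X),
    intervalIntegral.integral_congr_Ioo_of_le (g := fun _ => if X j then 1 else 0) hle]
  · simp only [intervalIntegral.integral_const, smul_eq_mul, ← sub_div, add_sub_cancel_left,
      one_div_mul_eq_div]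
  · intro x hx
    have hcell := Ioo_subset_Ico_self hx
    simp only [deckDensity, (cellIndex_eq_iff (Ico_div_subset_Ico j hcell)).mpr hcell]

theorem onesBefore_deckDensity_one (X : Fin N → Bool) :
    onesBefore (deckDensity X) 1 = (Finset.univ.filter fun i => X i = true).card / N := by
  have hN : (N : ℝ) ≠ 0 := mod_cast NeZero.ne N
  have hstep : ∀ j : Fin N, (if X j = true then (1 : ℝ) else 0) / N
      = onesBefore (deckDensity X) ((j + 1 : ℕ) / N) - onesBefore (deckDensity X) (j / N) :=
    fun j => by rw [Nat.cast_succ, onesBefore_deckDensity_succ, add_sub_cancel_left]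
  rw [← Finset.sum_boole, Finset.sum_div, Finset.sum_congr rfl fun j _ => hstep j,
    Fin.sum_univ_eq_sum_range fun m : ℕ => onesBefore (deckDensity X) ((m + 1 : ℕ) / N)
      - onesBefore (deckDensity X) (m / N),
    Finset.sum_range_sub fun m : ℕ => onesBefore (deckDensity X) (m / N)]
  simp [hN, onesBefore_zero]

end DeckDensity

section RoundedDeck

variable {N : ℕ} {f : ℝ → ℝ}

/-- The deck of `N` cards whose number of ones among the first `m` cards is `⌊N F(m/N)⌋`, where
`F` is the mass function of `f`. -/
noncomputable def roundedDeck (f : ℝ → ℝ) (N : ℕ) (j : Fin N) : Bool :=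
  decide (⌊N * onesBefore f (j / N)⌋₊ < ⌊N * onesBefore f ((j + 1) / N)⌋₊)

theorem natFloor_eq_add_ite {a b : ℝ} (ha : 0 ≤ a) (hab : a ≤ b) (hba : b ≤ a + 1) :
    ⌊b⌋₊ = ⌊a⌋₊ + if ⌊a⌋₊ < ⌊b⌋₊ then 1 else 0 := by
  have hlow := Nat.floor_le_floor hab
  have hhigh := Nat.floor_le_floor hba
  rw [Nat.floor_add_one ha] at hhigh
  split_ifs <;> lia

variable [NeZero N]

theorem onesBefore_roundedDeck_div (hf : IsSublebesgueDensity f) {m : ℕ} (hm : m ≤ N) :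
    onesBefore (deckDensity (roundedDeck f N)) (m / N) = ⌊N * onesBefore f (m / N)⌋₊ / N := by
  have hN : (0 : ℝ) < N := mod_cast NeZero.pos N
  induction m with
  | zero => simp [onesBefore_zero]
  | succ m ih =>
    have hstep : onesBefore f ((m + 1) / N) - onesBefore f (m / N)
        ∈ Icc 0 (((m : ℝ) + 1) / N - m / N) :=
      onesBefore_sub_mem_Icc hf (by gcongr; linarith)
    have hlength : N * (((m : ℝ) + 1) / N - m / N) = 1 := by field_simp; ring
    have hnonneg : 0 ≤ onesBefore f (m / N) := (onesBefore_mem_Icc hf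
      ⟨by positivity, div_le_one_of_le₀ (mod_cast (Nat.le_of_succ_le hm)) hN.le⟩).1
    have hfloor := natFloor_eq_add_ite (mul_nonneg hN.le hnonneg)
      (mul_le_mul_of_nonneg_left (sub_nonneg.mp hstep.1) hN.le)
      (by linarith [mul_le_mul_of_nonneg_left hstep.2 hN.le])
    have hcard := onesBefore_deckDensity_succ (roundedDeck f N) ⟨m, hm⟩
    simp only [roundedDeck, decide_eq_true_eq] at hcard
    rw [Nat.cast_succ, hcard, ih (Nat.le_of_succ_le hm), ← add_div]
    congr 1
    exact mod_cast hfloor.symm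

theorem card_roundedDeck (hf : IsSublebesgueDensity f) :
    (Finset.univ.filter fun i => roundedDeck f N i = true).card = ⌊N * onesBefore f 1⌋₊ := by
  have hN : (N : ℝ) ≠ 0 := mod_cast NeZero.ne N
  have hmass := onesBefore_roundedDeck_div hf (le_refl N)
  rw [div_self hN, onesBefore_deckDensity_one, div_left_inj' hN] at hmass
  exact mod_cast hmass

theorem abs_onesBefore_roundedDeck_sub_le (hf : IsSublebesgueDensity f) {s : ℝ}
    (hs : s ∈ Icc (0 : ℝ) 1) :
    |onesBefore (deckDensity (roundedDeck f N)) s - onesBefore f s| ≤ 2 / N := by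
  have hN : (0 : ℝ) < N := mod_cast NeZero.pos N
  have hNs : 0 ≤ N * s := mul_nonneg hN.le hs.1
  have hlow : (⌊N * s⌋₊ : ℝ) / N ≤ s := (div_le_iff₀' hN).mpr (Nat.floor_le hNs)
  have hhigh : s - ⌊N * s⌋₊ / N ≤ 1 / N := by
    rw [sub_le_iff_le_add', ← add_div, le_div_iff₀' hN]
    exact (Nat.lt_floor_add_one _).le
  have hnode := onesBefore_roundedDeck_div hf (N := N)
    (Nat.floor_le_of_le (mul_le_of_le_one_right hN.le hs.2))
  have hdeck := onesBefore_sub_mem_Icc (isSublebesgueDensity_deckDensity (roundedDeck f N)) hlow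
  have hmass := onesBefore_sub_mem_Icc hf hlow
  set F := onesBefore f (⌊N * s⌋₊ / N)
  have hF : 0 ≤ F := (onesBefore_mem_Icc hf ⟨by positivity, hlow.trans hs.2⟩).1
  have hround : (⌊N * F⌋₊ : ℝ) / N ∈ Icc (F - 1 / N) F := by
    constructor
    · rw [sub_le_iff_le_add, ← add_div, le_div_iff₀' hN]
      exact (Nat.lt_floor_add_one _).le
    · exact (div_le_iff₀' hN).mpr (Nat.floor_le (mul_nonneg hN.le hF))
  have htwo : (2 : ℝ) / N = 1 / N + 1 / N := by ring
  rw [hnode] at hdeck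
  rw [abs_le, htwo]
  constructor <;> linarith [hdeck.1, hdeck.2, hmass.1, hmass.2, hround.1, hround.2]

end RoundedDeck

section DeckLimit

variable {n : ℕ}

theorem patternDensity_word1010_le_of_onesBefore_one_eq_half {f : ℝ → ℝ}
    (hf : IsSublebesgueDensity f) (hmass : onesBefore f 1 = 1 / 2) :
    patternDensity word1010 (withUnitDensity f) ≤ 3 / (4 * Real.exp 1 ^ 2) := by
  refine (patternDensity_word1010_le hf).trans_eq ?_
  rw [hmass]
  field_simp
  norm_num

theorem patternDensity_word1010_optimalDensity_half :
    patternDensity word1010 (withUnitDensity (optimalDensity (1 / 2)))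
      = 3 / (4 * Real.exp 1 ^ 2) := by
  rw [patternDensity_word1010_optimalDensity (by norm_num) (by norm_num)]
  field_simp
  norm_num

theorem word1010_castSucc_ne_succ (i : Fin 3) : word1010 i.castSucc ≠ word1010 i.succ := by
  fin_cases i <;> simp [word1010]

theorem wordDensity_word1010_le [NeZero n] (X : Fin (2 * n) → Bool)
    (hX : (Finset.univ.filter fun i => X i = true).card = n) :
    wordDensity word1010 X ≤ 3 / (4 * Real.exp 1 ^ 2)
      * (((2 * n : ℕ) : ℝ) ^ 4 / (Nat.factorial 4 * (2 * n).choose 4)) := by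
  have hn : (n : ℝ) ≠ 0 := mod_cast NeZero.ne n
  rw [wordDensity_eq_patternDensity_mul X word1010_castSucc_ne_succ]
  gcongr
  refine patternDensity_word1010_le_of_onesBefore_one_eq_half
    (isSublebesgueDensity_deckDensity X) ?_
  rw [onesBefore_deckDensity_one, hX]
  push_cast
  field_simp

theorem exists_le_wordDensity_word1010 (n : ℕ) [NeZero n] :
    ∃ X : Fin (2 * n) → Bool, (Finset.univ.filter fun i => X i = true).card = n ∧
      (3 / (4 * Real.exp 1 ^ 2) - 192 / n)
        * (((2 * n : ℕ) : ℝ) ^ 4 / (Nat.factorial 4 * (2 * n).choose 4))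
        ≤ wordDensity word1010 X := by
  have hn : (n : ℝ) ≠ 0 := mod_cast NeZero.ne n
  have hf : IsSublebesgueDensity (optimalDensity (1 / 2)) :=
    isSublebesgueDensity_optimalDensity (by norm_num) (by norm_num)
  have hmass : onesBefore (optimalDensity (1 / 2)) 1 = 1 / 2 :=
    onesBefore_optimalDensity_one (by norm_num) (by norm_num)
  set X := roundedDeck (optimalDensity (1 / 2)) (2 * n)
  have hclose := abs_patternDensity_sub_le (isSublebesgueDensity_deckDensity X) hf
    (fun s hs => abs_onesBefore_roundedDeck_sub_le hf hs) word1010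
  have herror : ((4).factorial : ℝ) * (2 * (4 : ℕ) * (2 / (2 * n : ℕ))) = 192 / n := by
    simp only [Nat.factorial]
    push_cast
    field_simp
    norm_num
  rw [patternDensity_word1010_optimalDensity_half, herror] at hclose
  refine ⟨X, ?_, ?_⟩
  · rw [card_roundedDeck hf, hmass]
    simp [mul_comm]
  · rw [wordDensity_eq_patternDensity_mul X word1010_castSucc_ne_succ]
    gcongr
    linarith [(abs_le.mp hclose).1]

theorem tendsto_pow_div_factorial_mul_choose (k : ℕ) :
    Tendsto (fun N : ℕ => (N : ℝ) ^ k / (k.factorial * N.choose k)) atTop (𝓝 1) := by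
  have hne : ∀ᶠ N : ℕ in atTop, (N.choose k : ℝ) ≠ 0 := by
    filter_upwards [eventually_ge_atTop k] with N hN
    exact_mod_cast (Nat.choose_pos hN).ne'
  refine ((Asymptotics.isEquivalent_iff_tendsto_one hne).mp (isEquivalent_choose k).symm).congr
    fun N => ?_
  rw [Pi.div_apply, div_div]

theorem exists_isGreatest_brbrProbabilities (n : ℕ) :
    ∃ p, IsGreatest (brbrProbabilities n) p := by
  have hfinite : (brbrProbabilities n).Finite :=
    (finite_range fun X : Fin (2 * n) → Bool => wordDensity word1010 X).subset
      fun _ ⟨X, _, hp⟩ => ⟨X, hp.symm⟩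
  have hnonempty : (brbrProbabilities n).Nonempty :=
    ⟨_, fun i => decide ((i : ℕ) < n), by
      simp only [decide_eq_true_eq, Fin.card_filter_val_lt]
      lia, rfl⟩
  exact hfinite.isCompact.exists_isGreatest hnonempty

theorem tendsto_of_isGreatest_brbrProbabilities {M : ℕ → ℝ}
    (hM : ∀ n, IsGreatest (brbrProbabilities n) (M n)) :
    Tendsto M atTop (𝓝 (3 / (4 * Real.exp 1 ^ 2))) := by
  have hratio : Tendsto (fun n : ℕ => (((2 * n : ℕ) : ℝ) ^ 4
      / (Nat.factorial 4 * (2 * n).choose 4))) atTop (𝓝 1) :=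
    (tendsto_pow_div_factorial_mul_choose 4).comp (tendsto_id.const_mul_atTop' two_pos)
  have hlower : Tendsto (fun n : ℕ => 3 / (4 * Real.exp 1 ^ 2) - 192 / (n : ℝ)) atTop
      (𝓝 (3 / (4 * Real.exp 1 ^ 2))) := by
    simpa only [sub_zero] using
      tendsto_const_nhds.sub (tendsto_const_div_atTop_nhds_zero_nat (192 : ℝ))
  refine tendsto_of_tendsto_of_tendsto_of_le_of_le'
    (by simpa only [mul_one] using hlower.mul hratio)
    (by simpa only [mul_one] using hratio.const_mul (3 / (4 * Real.exp 1 ^ 2))) ?_ ?_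
  · filter_upwards [eventually_ne_atTop 0] with n hn
    have : NeZero n := ⟨hn⟩
    obtain ⟨X, hX, hle⟩ := exists_le_wordDensity_word1010 n
    exact hle.trans ((hM n).2 ⟨X, hX, rfl⟩)
  · filter_upwards [eventually_ne_atTop 0] with n hn
    have : NeZero n := ⟨hn⟩
    obtain ⟨X, hX, hMX⟩ := (hM n).1
    exact hMX.trans_le (wordDensity_word1010_le X hX)

end DeckLimit

theorem mainTheorem3 :
    (∀ ρ : ℝ, 0 ≤ ρ → ρ ≤ 1 →
      IsGreatest (patternDensity word1010 '' sublebesgueWithMass ρ)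
        (12 / Real.exp 1 ^ 2 * ρ ^ 2 * (1 - ρ) ^ 2) ∧
      ∃ μ ∈ sublebesgueWithMass ρ,
        patternDensity word1010 μ = 12 / Real.exp 1 ^ 2 * ρ ^ 2 * (1 - ρ) ^ 2 ∧
        unitDensity μ =ᵐ[lebesgueUnit] optimalDensity ρ ∧
        ∀ ν ∈ sublebesgueWithMass ρ,
          patternDensity word1010 ν = 12 / Real.exp 1 ^ 2 * ρ ^ 2 * (1 - ρ) ^ 2 → ν = μ) ∧
    ∃ M : ℕ → ℝ, (∀ n, IsGreatest (brbrProbabilities n) (M n)) ∧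
      Tendsto M atTop (𝓝 (3 / (4 * Real.exp 1 ^ 2))) := by
  refine ⟨fun ρ h0 h1 => ⟨isGreatest_patternDensity_word1010 h0 h1,
    withUnitDensity (optimalDensity ρ), withUnitDensity_optimalDensity_mem h0 h1,
    patternDensity_word1010_optimalDensity h0 h1,
    unitDensity_withUnitDensity (isSublebesgueDensity_optimalDensity h0 h1),
    fun ν => eq_withUnitDensity_optimalDensity_of_maximal⟩, ?_⟩
  choose M hM using exists_isGreatest_brbrProbabilities
  exact ⟨M, hM, tendsto_of_isGreatest_brbrProbabilities hM⟩
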